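/- Let $M=\langle S,\bar s,A,E,\Delta\rangle$ be a Markov decision process: $S$ and $A$ are finite, $\bar s\in S$ is the initial state, $E(s)\subseteq A$ is the non-empty set of actions enabled in $s$, and $\Delta(s,a)$ is a probability distribution on $S$ for $a\in E(s)$. Let $0\neq 1$ be two distinguished states that are terminal, i.e. $\Delta(s,a)(s)=1$ for $s\in\{0,1\}$ and $a\in E(s)$; the set of target states is $F=\{1\}$. Write $V(s)=\sup_\sigma \Pr^\sigma_{s}(\Diamond F)$ for the supremum, over all history-dependent randomised strategies, of the probability of reaching $F$ from $s$, and $V(s,a)=\sum_{s'}\Delta(s,a)(s')V(s')$ for $a\in E(s)$. An end component is a pair $(T,B)$ of a set $T$ of states and a non-empty set $B$ of state-action pairs $(s,a)$ with $s\in T$, $a\in E(s)$, such that $\Delta(s,a)(s')>0$ with $(s,a)\in B$ implies $s'\in T$, and any two states of $T$ are connected by a path that uses only pairs of $B$. For $W:S\times A\to[0,1]$ put $W(s)=\max_{a\in E(s)}W(s,a)$. The algorithm BRTDP with precision $\varepsilon>0$ keeps bounds $U,L:S\times A\to[0,1]$, initially $U(0,\cdot)=0$ and $U(s,\cdot)=1$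 for $s\ne 0$, $L(1,\cdot)=1$ and $L(s,\cdot)=0$ for $s\neq 1$. It repeats the following iteration. (Explore) Starting with $\omega=\bar s$, repeat: draw $a$ uniformly from $\arg\max_{a\in E(s)}U(s,a)$, where $s$ is the last state of $\omega$, draw $s'$ from $\Delta(s,a)$, and append $a\,s'$ to $\omega$; until $s'\in\{0,1\}$. (Update) Repeat: remove the last action $a$ and the last state from $\omega$, let $s$ be the state in which $\omega$ now ends, and assign $U(s,a):=\sum_{s'}\Delta(s,a)(s')U(s')$ and $L(s,a):=\sum_{s'}\Delta(s,a)(s')L(s')$; until $\omega=\bar s$. The algorithm terminates at the end of the first iteration after which $U(\bar s)-L(\bar s)<\varepsilon$. Assume that every end component $(T,B)$ of $M$ has $T=\{0\}$ or $T=\{1\}$. Then: 1. (Almost sure convergence) For every $\varepsilon>0$, BRTDP with precision $\varepsilon$ almost surely terminates, with $U(\bar s)-L(\bar s)<\varepsilon$ and $L(\bar s,a)\le V(\bar s,a)\le U(\bar s,a)$ for all $a\in E(\bar s)$. 2. In every computation of the algorithm, whatever the stopping condition, for all $s\in S$ and $a\in E(s)$, $U(s,a)$ never increases, $L(s,a)$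 never decreases, and $L(s,a)\le V(s,a)\le U(s,a)$ holds at all times. 3. If the iteration is repeated forever, without the termination test, then almost surely every iteration is completed, and the bounds $U_i,L_i$ after $i$ iterations satisfy $U_i(s,a)\ge U_j(s,a)\ge V(s,a)\ge L_j(s,a)\ge L_i(s,a)$ for all $i\le j$, $s\in S$, $a\in E(s)$, and $\lim_{i\to\infty}\bigl(U_i(\bar s)-L_i(\bar s)\bigr)=0$. -/

import Mathlib

open MeasureTheory ProbabilityTheory Filter Topology

/-! ## Markov chains on a discrete state space -/

section MarkovChain

variable {X : Type*} [MeasurableSpace X] [DiscreteMeasurableSpace X]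

/-- The kernel on the histories `x 0, …, x n` that draws `x (n + 1)` from `step (x n)`. -/
noncomputable def chainKernel (step : X → PMF X) (n : ℕ) :
    Kernel ((i : Finset.Iic n) → (fun _ : ℕ => X) i) X where
  toFun h := (step (h ⟨n, Finset.mem_Iic.mpr le_rfl⟩)).toMeasure
  measurable' :=
    (Measurable.of_discrete (f := fun x : X => (step x).toMeasure)).comp (measurable_pi_apply _)

instance chainKernel_isMarkovKernel (step : X → PMF X) (n : ℕ) :
    IsMarkovKernel (chainKernel step n) :=
  ⟨fun h => inferInstanceAs
    (IsProbabilityMeasure (step (h ⟨n, Finset.mem_Iic.mpr le_rfl⟩)).toMeasure)⟩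

/-- The law, on infinite sequences, of the Markov chain that starts in `x₀` and moves from `x` to
a successor drawn from `step x`. -/
noncomputable def chainLaw (step : X → PMF X) (x₀ : X) : Measure (ℕ → X) :=
  Kernel.trajMeasure (X := fun _ : ℕ => X) (Measure.dirac x₀) (chainKernel step)

end MarkovChain

/-! ## Markov decision processes -/

/-- A Markov decision process with states `S` and actions `A`. Only the values `Δ s a` with
`a ∈ E s` matter; the other ones are irrelevant. -/
structure MDP (S A : Type*) where
  /-- the initial state -/
  init : S
  /-- the enabled actions -/
  E : S → Finset A
  E_nonempty : ∀ s, (E s).Nonempty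
  /-- the transition probabilities -/
  Δ : S → A → PMF S

/-- Finite sequences `s₀ a₀ s₁ a₁ … sₙ` of alternating states and actions. -/
inductive FinPath (S A : Type*) where
  | start (s : S) : FinPath S A
  | snoc (ω : FinPath S A) (a : A) (s : S) : FinPath S A

/-- The last state of a finite sequence. -/
def FinPath.last {S A : Type*} : FinPath S A → S
  | start s => s
  | snoc _ _ s => s

instance {S A : Type*} : MeasurableSpace (FinPath S A) := ⊤

instance {S A : Type*} : DiscreteMeasurableSpace (FinPath S A) := ⟨fun _ => trivial⟩

namespace MDP

variable {S A : Type*} (M : MDP S A)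

/-- A state is terminal if every enabled action returns to it with probability one. -/
def IsTerminal (s : S) : Prop := ∀ a ∈ M.E s, M.Δ s a s = 1

/-- `(T, B)` is an end component: `T` is a set of states and `B` a nonempty set of actions enabled
in states of `T`, each action being recorded with the state in which it is taken, such that actions
of `B` never leave `T` and any two states of `T` are connected by a path using only actions
of `B`. -/
def IsEndComponent (T : Set S) (B : Set (S × A)) : Prop :=
  B.Nonempty ∧
  (∀ p ∈ B, p.1 ∈ T ∧ p.2 ∈ M.E p.1) ∧
  (∀ p ∈ B, ∀ s', 0 < M.Δ p.1 p.2 s' → s' ∈ T) ∧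
  (∀ s ∈ T, ∀ s' ∈ T,
    Relation.ReflTransGen (fun x y => ∃ a, (x, a) ∈ B ∧ 0 < M.Δ x a y) s s')

/-- `zero` and `one` are distinct terminal states, and there are no end components besides the
trivial ones consisting of one of these two states. -/
structure OnlyTrivialECs (zero one : S) : Prop where
  ne : zero ≠ one
  terminal_zero : M.IsTerminal zero
  terminal_one : M.IsTerminal one
  trivial_of_ec : ∀ T B, M.IsEndComponent T B → T = {zero} ∨ T = {one}

/-- A (history-dependent, randomised) strategy. -/
structure Strategy where
  act : FinPath S A → PMF A
  enabled : ∀ ω, ∀ a ∈ (act ω).support, a ∈ M.E ω.last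

/-- One step under a strategy: extend `ω` by an action drawn from the strategy and a successor
state drawn from the transition probabilities. -/
noncomputable def strategyStep (σ : M.Strategy) (ω : FinPath S A) : PMF (FinPath S A) :=
  (σ.act ω).bind fun a => (M.Δ ω.last a).map fun s => ω.snoc a s

/-- The probability measure induced by a strategy and a state `s`; an infinite path is represented
by the sequence of its finite prefixes. -/
noncomputable def pathMeasure (σ : M.Strategy) (s : S) : Measure (ℕ → FinPath S A) :=
  chainLaw (M.strategyStep σ) (FinPath.start s)

/-- The probability of reaching the set `F` from `s` under the strategy `σ`. -/
noncomputable def reachProb (F : Set S) (σ : M.Strategy) (s : S) : ℝ :=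
  (M.pathMeasure σ s).real {ω | ∃ n, (ω n).last ∈ F}

/-- The value `V(s)`: the supremum over all strategies of the probability of reaching `F`. -/
noncomputable def stateValue (F : Set S) (s : S) : ℝ :=
  ⨆ σ : M.Strategy, M.reachProb F σ s

/-- The value `V(s, a) = ∑ s', Δ(s, a)(s') V(s')` of a state-action pair. -/
noncomputable def value [Fintype S] (F : Set S) (s : S) (a : A) : ℝ :=
  ∑ s', (M.Δ s a s').toReal * M.stateValue F s'

/-- The maximum of `W(s, a)` over the actions `a` enabled in `s`. -/
noncomputable def maxE (W : S → A → ℝ) (s : S) : ℝ :=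
  (M.E s).sup' (M.E_nonempty s) (W s)

open Classical in
/-- The enabled actions of `s` at which `W(s, ·)` is maximal. -/
noncomputable def argmaxE (W : S → A → ℝ) (s : S) : Finset A :=
  (M.E s).filter fun a => ∀ b ∈ M.E s, W s b ≤ W s a

theorem argmaxE_nonempty (W : S → A → ℝ) (s : S) : (M.argmaxE W s).Nonempty := by
  obtain ⟨a, ha, h⟩ := Finset.exists_max_image (M.E s) (W s) (M.E_nonempty s)
  exact ⟨a, by simp only [argmaxE, Finset.mem_filter]; exact ⟨ha, h⟩⟩

end MDP

/-! ## The algorithm BRTDP -/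

namespace BRTDP

/-- The phases of a computation. -/
inductive Phase where
  | explore
  | update
  | halted

/-- A configuration of the algorithm: the current phase, the path `ω`, the current bounds `U`, `L`,
and the number `iter` of completed iterations of the outer loop. -/
structure Config (S A : Type*) where
  phase : Phase
  path : FinPath S A
  U : S → A → ℝ
  L : S → A → ℝ
  iter : ℕ

instance {S A : Type*} : MeasurableSpace (Config S A) := ⊤

instance {S A : Type*} : DiscreteMeasurableSpace (Config S A) := ⟨fun _ => trivial⟩

variable {S A : Type*} [Fintype S] (M : MDP S A) (zero one : S)

open Classical in
/-- The initial configuration: `U = 1` except that `U(0, ·) = 0`, and `L = 0` except that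
`L(1, ·) = 1`. -/
noncomputable def initial : Config S A where
  phase := .explore
  path := .start M.init
  U s _ := if s = zero then 0 else 1
  L s _ := if s = one then 1 else 0
  iter := 0

open Classical in
/-- The assignment `W(s, a) := ∑ s', Δ(s, a)(s') · max_{b ∈ E(s')} W(s', b)`. -/
noncomputable def backup (W : S → A → ℝ) (s : S) (a : A) : S → A → ℝ :=
  fun t b => if t = s ∧ b = a then ∑ s', (M.Δ s a s').toReal * M.maxE W s' else W t b

open Classical in
/-- One step of the exploration: draw an action uniformly among those maximising `U` in the last
state of the path, draw a successor, and append both to the path. The exploration ends when the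
successor is one of the two terminal states. -/
noncomputable def exploreStep (c : Config S A) : PMF (Config S A) :=
  (PMF.uniformOfFinset (M.argmaxE c.U c.path.last) (M.argmaxE_nonempty c.U c.path.last)).bind
    fun a => (M.Δ c.path.last a).map fun s =>
      { c with
        phase := if s = one ∨ s = zero then .update else .explore
        path := c.path.snoc a s }

open Classical in
/-- One step of the update phase: remove the last action and state from the path and update the
bounds of the state-action pair that is now at its end. The phase ends when the path consists of
the initial state only; this completes an iteration of the outer loop, and the algorithm halts if
the stopping condition `quit U L` holds, and begins the next iteration otherwise. -/
noncomputable def updateStep (quit : (S → A → ℝ) → (S → A → ℝ) → Prop) (c : Config S A) :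
    Config S A :=
  match c.path with
  | .start _ => c
  | .snoc ω a _ =>
    let U' := backup M c.U ω.last a
    let L' := backup M c.L ω.last a
    match ω with
    | .start s =>
      { phase := if quit U' L' then .halted else .explore
        path := .start s
        U := U'
        L := L'
        iter := c.iter + 1 }
    | .snoc _ _ _ => { c with path := ω, U := U', L := L' }

/-- One step of the algorithm with stopping condition `quit`. -/
noncomputable def step (quit : (S → A → ℝ) → (S → A → ℝ) → Prop) (c : Config S A) :
    PMF (Config S A) :=
  match c.phase with
  | .explore => exploreStep M zero one c
  | .update => PMF.pure (updateStep M quit c)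
  | .halted => PMF.pure c

/-- The law of the computation of the algorithm with stopping condition `quit`. -/
noncomputable def law (quit : (S → A → ℝ) → (S → A → ℝ) → Prop) : Measure (ℕ → Config S A) :=
  chainLaw (step M zero one quit) (initial M zero one)

/-- A possible computation: it starts in the initial configuration, and each step has positive
probability. -/
def IsComputation (quit : (S → A → ℝ) → (S → A → ℝ) → Prop) (ρ : ℕ → Config S A) : Prop :=
  ρ 0 = initial M zero one ∧ ∀ n, ρ (n + 1) ∈ (step M zero one quit (ρ n)).support

/-- The stopping condition of precision `ε`:
`max_{a ∈ E(init)} U(init, a) - max_{a ∈ E(init)} L(init, a) < ε`. -/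
def precise (ε : ℝ) (U L : S → A → ℝ) : Prop := M.maxE U M.init - M.maxE L M.init < ε

/-- The stopping condition that never holds: the outer loop is iterated forever. -/
def never (_ _ : S → A → ℝ) : Prop := False

/-- The configuration of `ρ` right after the `i`-th iteration of the outer loop (the initial one
if `i = 0`); meaningful if the `i`-th iteration is ever completed. -/
noncomputable def afterIter (ρ : ℕ → Config S A) (i : ℕ) : Config S A :=
  ρ (sInf {n | (ρ n).iter = i})

end BRTDP

/-!
The value `V` satisfies the optimality equation: finite-horizon values bound it from below, and
every nonnegative superharmonic function that is at least `1` on the target bounds it from above.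
The initial `U` and `L` are a super- and a subsolution of that equation, which the assignments
preserve; this gives monotonicity and `L ≤ V ≤ U`.

By Lévy's conditional Borel-Cantelli lemma, almost surely all successors of a state-action pair that
is drawn infinitely often are drawn infinitely often. Hence an exploration that went on forever
would revisit a set of nonterminal states closed under some actions, and such a set contains an end
component. If there are infinitely many iterations, the limits of `U` and `L` satisfy the one-step
equation at every pair drawn infinitely often, so their gap is subharmonic on the states visited
infinitely often. By the maximum principle a positive gap would again produce an end component of
nonterminal states.
-/

/-! ## Conditional Borel-Cantelli for Markov chains -/

section MarkovChain

open Preorder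
open scoped ENNReal

variable {X : Type*} [MeasurableSpace X] [DiscreteMeasurableSpace X]

instance chainLaw_isProbabilityMeasure (step : X → PMF X) (x₀ : X) :
    IsProbabilityMeasure (chainLaw step x₀) :=
  inferInstanceAs (IsProbabilityMeasure
    (Kernel.trajMeasure (X := fun _ : ℕ => X) (Measure.dirac x₀) (chainKernel step)))

theorem measurableSet_apply_mem (n : ℕ) (G : Set X) : MeasurableSet {ρ : ℕ → X | ρ n ∈ G} :=
  measurable_pi_apply n MeasurableSet.of_discrete

theorem chainLaw_eq_traj (step : X → PMF X) (x₀ : X) :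
    chainLaw step x₀ =
      Kernel.traj (X := fun _ : ℕ => X) (chainKernel step) 0 fun _ => x₀ := by
  rw [chainLaw, Kernel.trajMeasure, Measure.map_dirac' (MeasurableEquiv.measurable _),
    Measure.dirac_bind (Kernel.measurable _)]
  rfl

theorem chainLaw_ae_zero (step : X → PMF X) (x₀ : X) : ∀ᵐ ρ ∂(chainLaw step x₀), ρ 0 = x₀ := by
  have h : (chainLaw step x₀).map (frestrictLe (π := fun _ : ℕ => X) 0) =
      Measure.dirac fun _ => x₀ := by
    rw [chainLaw_eq_traj, Kernel.traj_map_frestrictLe_apply, Kernel.partialTraj_self,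
      Kernel.id_apply]
  have h₀ : ∀ᵐ z ∂((chainLaw step x₀).map (frestrictLe (π := fun _ : ℕ => X) 0)),
      z ⟨0, Finset.mem_Iic.mpr le_rfl⟩ = x₀ := by
    rw [h, ae_dirac_iff]
    exact (measurable_pi_apply _ : Measurable fun z : (i : Finset.Iic 0) → (fun _ : ℕ => X) i =>
      z ⟨0, Finset.mem_Iic.mpr le_rfl⟩) (MeasurableSet.of_discrete (s := {x₀}))
  exact ae_of_ae_map (measurable_frestrictLe 0).aemeasurable h₀

theorem map_chainLaw_pair (step : X → PMF X) (x₀ : X) (n : ℕ) :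
    ((chainLaw step x₀).map (frestrictLe (π := fun _ : ℕ => X) n)) ⊗ₘ chainKernel step n =
      (chainLaw step x₀).map fun ρ => (frestrictLe (π := fun _ : ℕ => X) n ρ, ρ (n + 1)) :=
  Kernel.map_frestrictLe_trajMeasure_compProd_eq_map_trajMeasure

theorem lintegral_chainLaw_succ (step : X → PMF X) (x₀ : X) (n : ℕ) {f : X → ℝ≥0∞} :
    ∫⁻ ρ, f (ρ (n + 1)) ∂(chainLaw step x₀) =
      ∫⁻ ρ, ∫⁻ y, f y ∂(step (ρ n)).toMeasure ∂(chainLaw step x₀) := by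
  have key := congrArg (fun ν => ∫⁻ p, f p.2 ∂ν) (map_chainLaw_pair step x₀ n)
  have hf : Measurable fun p : ((i : Finset.Iic n) → (fun _ : ℕ => X) i) × X => f p.2 :=
    (Measurable.of_discrete (f := f)).comp measurable_snd
  rw [Measure.lintegral_compProd hf, lintegral_map hf (by fun_prop),
    lintegral_map hf.lintegral_kernel_prod_right' (by fun_prop)] at key
  exact key.symm

theorem chainLaw_ae_succ_mem (step : X → PMF X) (x₀ : X) (n : ℕ) {G H : Set X}
    (h : ∀ x ∈ G, (step x).support ⊆ H) :
    ∀ᵐ ρ ∂(chainLaw step x₀), ρ n ∈ G → ρ (n + 1) ∈ H := by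
  let last : ((i : Finset.Iic n) → (fun _ : ℕ => X) i) → X :=
    fun z => z ⟨n, Finset.mem_Iic.mpr le_rfl⟩
  have hpair : ∀ᵐ p ∂((chainLaw step x₀).map fun ρ =>
      (frestrictLe (π := fun _ : ℕ => X) n ρ, ρ (n + 1))), last p.1 ∈ G → p.2 ∈ H := by
    rw [← map_chainLaw_pair]
    refine Measure.ae_compProd_of_ae_ae ?_ (.of_forall fun z => ?_)
    · have hlast :
          MeasurableSet {p : ((i : Finset.Iic n) → (fun _ : ℕ => X) i) × X | last p.1 ∈ G} :=
        ((measurable_pi_apply _).comp measurable_fst) MeasurableSet.of_discrete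
      exact hlast.imp (measurable_snd MeasurableSet.of_discrete)
    · by_cases hz : last z ∈ G
      · have hH : ∀ᵐ y ∂(step (last z)).toMeasure, y ∈ H := by
          rw [ae_iff]
          exact (PMF.toMeasure_apply_eq_zero_iff _ MeasurableSet.of_discrete).mpr
            (Set.disjoint_compl_right_iff_subset.mpr (h _ hz))
        exact hH.mono fun y hy _ => hy
      · exact .of_forall fun y hy => absurd hy hz
  exact ae_of_ae_map (by fun_prop) hpair

theorem chainLaw_exists_countable (step : X → PMF X) (x₀ : X) (n : ℕ) :
    ∃ C : Set X, C.Countable ∧ ∀ᵐ ρ ∂(chainLaw step x₀), ρ n ∈ C := by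
  induction n with
  | zero => exact ⟨{x₀}, Set.countable_singleton _, chainLaw_ae_zero step x₀⟩
  | succ n ih =>
    obtain ⟨C, hC, hmem⟩ := ih
    refine ⟨⋃ x ∈ C, (step x).support, hC.biUnion fun x _ => (step x).support_countable, ?_⟩
    filter_upwards [hmem, chainLaw_ae_succ_mem step x₀ n fun x hx =>
      Set.subset_biUnion_of_mem (u := fun x => (step x).support) hx] with ρ h hsucc using hsucc h

theorem chainLaw_ae_mem_support (step : X → PMF X) (x₀ : X) :
    ∀ᵐ ρ ∂(chainLaw step x₀), ∀ n, ρ (n + 1) ∈ (step (ρ n)).support := by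
  refine ae_all_iff.mpr fun n => ?_
  obtain ⟨C, hC, hmem⟩ := chainLaw_exists_countable step x₀ n
  have h : ∀ᵐ ρ ∂(chainLaw step x₀), ∀ x ∈ C, ρ n = x → ρ (n + 1) ∈ (step x).support :=
    (ae_ball_iff hC).mpr fun x _ => chainLaw_ae_succ_mem step x₀ n (G := {x}) (by rintro _ rfl; rfl)
  filter_upwards [h, hmem] with ρ hstep hρ using hstep _ hρ rfl

theorem condExp_chainLaw_indicator (step : X → PMF X) (x₀ : X) (n : ℕ) (G H : Set X) :
    (chainLaw step x₀)[{ρ | ρ n ∈ G ∧ ρ (n + 1) ∈ H}.indicator 1 |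
        Filtration.piLE (X := fun _ : ℕ => X) n] =ᵐ[chainLaw step x₀]
      fun ρ => G.indicator (fun x => (step x).toMeasure.real H) (ρ n) := by
  have hmeas : MeasurableSet {ρ : ℕ → X | ρ n ∈ G ∧ ρ (n + 1) ∈ H} :=
    (measurableSet_apply_mem n G).inter (measurableSet_apply_mem (n + 1) H)
  have hf : Measurable ({ρ : ℕ → X | ρ n ∈ G ∧ ρ (n + 1) ∈ H}.indicator (1 : (ℕ → X) → ℝ)) :=
    measurable_one.indicator hmeas
  rw [chainLaw_eq_traj]
  refine (Kernel.condExp_traj n.zero_le ((integrable_const 1).indicator hmeas)).trans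
    (.of_forall fun ρ => ?_)
  have hnext : ((Kernel.traj (X := fun _ : ℕ => X) (chainKernel step) n)
      (frestrictLe n ρ)).real {z | z (n + 1) ∈ H} = (step (ρ n)).toMeasure.real H := by
    have h := congrArg (fun κ => (κ (frestrictLe n ρ)).real H)
      (Kernel.map_traj_succ_self (X := fun _ : ℕ => X) (κ := chainKernel step) (a := n))
    rw [Kernel.map_apply _ (by fun_prop), measureReal_def, Measure.map_apply (by fun_prop)
      MeasurableSet.of_discrete] at h
    exact h
  have hupdate (z : ℕ → X) :
      {ρ : ℕ → X | ρ n ∈ G ∧ ρ (n + 1) ∈ H}.indicator (1 : (ℕ → X) → ℝ)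
          (Function.updateFinset z (Finset.Iic n) (frestrictLe (π := fun _ : ℕ => X) n ρ)) =
        {z : ℕ → X | ρ n ∈ G ∧ z (n + 1) ∈ H}.indicator 1 z := by
    have hn : Function.updateFinset z (Finset.Iic n) (frestrictLe n ρ) n = ρ n :=
      dif_pos (Finset.mem_Iic.mpr le_rfl)
    have hn' : Function.updateFinset z (Finset.Iic n) (frestrictLe n ρ) (n + 1) = z (n + 1) :=
      dif_neg (by simp)
    classical
    simp only [Set.indicator_apply, Set.mem_ofPred_eq, hn, hn', Pi.one_apply]
  refine (Kernel.integral_traj _ hf.aestronglyMeasurable).trans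
    ((integral_congr_ae (.of_forall hupdate)).trans ?_)
  by_cases hG : ρ n ∈ G
  · simpa only [hG, true_and, Set.indicator_of_mem, ← hnext] using
      integral_indicator_one (measurableSet_apply_mem (n + 1) H)
  · simp [hG]

theorem chainLaw_ae_frequently_iff (step : X → PMF X) (x₀ : X) (G H : Set X) :
    ∀ᵐ ρ ∂(chainLaw step x₀), (∃ᶠ n in atTop, ρ n ∈ G ∧ ρ (n + 1) ∈ H) ↔
      Tendsto (fun n => ∑ k ∈ Finset.range n,
        G.indicator (fun x => (step x).toMeasure.real H) (ρ k)) atTop atTop := by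
  let s : ℕ → Set (ℕ → X) := fun k => {ρ | ρ (k - 1) ∈ G ∧ ρ k ∈ H}
  have hs (k : ℕ) :
      MeasurableSet[Filtration.piLE (X := fun _ : ℕ => X) k] (s k) := by
    rw [Filtration.piLE_eq_comap_frestrictLe]
    refine ⟨{z | z ⟨k - 1, Finset.mem_Iic.mpr (Nat.sub_le k 1)⟩ ∈ G ∧
      z ⟨k, Finset.mem_Iic.mpr le_rfl⟩ ∈ H}, ?_, rfl⟩
    exact (measurable_pi_apply _ MeasurableSet.of_discrete).inter
      (measurable_pi_apply _ MeasurableSet.of_discrete)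
  filter_upwards [ae_mem_limsup_atTop_iff (chainLaw step x₀) hs,
    ae_all_iff.mpr fun n => condExp_chainLaw_indicator step x₀ n G H] with ρ hlevy hcond
  have hshift : (∃ᶠ n in atTop, ρ n ∈ G ∧ ρ (n + 1) ∈ H) ↔ ∃ᶠ n in atTop, ρ ∈ s n := by
    conv_rhs => rw [← map_add_atTop_eq_nat 1, frequently_map]
    rfl
  rw [hshift, ← mem_limsup_iff_frequently_mem, hlevy]
  simp only [← hcond]
  rfl

theorem chainLaw_ae_fair (step : X → PMF X) (x₀ : X) {G H H' : Set X} {c : ℝ} (hc : 0 < c)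
    (hle : ∀ x ∈ G, c * (step x).toMeasure.real H ≤ (step x).toMeasure.real H') :
    ∀ᵐ ρ ∂(chainLaw step x₀), (∃ᶠ n in atTop, ρ n ∈ G ∧ ρ (n + 1) ∈ H) →
      ∃ᶠ n in atTop, ρ n ∈ G ∧ ρ (n + 1) ∈ H' := by
  filter_upwards [chainLaw_ae_frequently_iff step x₀ G H,
    chainLaw_ae_frequently_iff step x₀ G H'] with ρ hH hH'
  rw [hH, hH']
  refine fun h => tendsto_atTop_mono (fun n => ?_) (h.const_mul_atTop hc)
  rw [Finset.mul_sum]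
  refine Finset.sum_le_sum fun k _ => ?_
  by_cases hk : ρ k ∈ G
  · simpa only [Set.indicator_of_mem hk] using hle _ hk
  · simp only [Set.indicator_of_notMem hk, mul_zero, le_refl]

end MarkovChain

/-! ## One-step expectations and closed sets of states -/

section PMF

open scoped ENNReal

variable {X Y : Type*}

theorem lintegral_pmf_toMeasure [MeasurableSpace X] [DiscreteMeasurableSpace X] (p : PMF X)
    (f : X → ℝ≥0∞) : ∫⁻ x, f x ∂p.toMeasure = ∑' x, p x * f x := by
  rw [← PMF.restrict_toMeasure_support p, lintegral_countable f p.support_countable,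
    ← tsum_subtype_eq_of_support_subset (s := p.support)]
  · refine tsum_congr fun x => ?_
    rw [PMF.toMeasure_apply_singleton _ _ (MeasurableSet.singleton _), mul_comm]
  · exact fun x hx hp => hx (by simp only [hp, zero_mul])

theorem tsum_bind_mul (p : PMF Y) (k : Y → PMF X) (f : X → ℝ≥0∞) :
    ∑' x, p.bind k x * f x = ∑' y, p y * ∑' x, k y x * f x := by
  simp only [PMF.bind_apply, ← ENNReal.tsum_mul_right, ← ENNReal.tsum_mul_left, mul_assoc]
  exact ENNReal.tsum_comm

theorem tsum_pure_mul (x : X) (f : X → ℝ≥0∞) : ∑' y, PMF.pure x y * f y = f x := by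
  rw [tsum_eq_single x fun y hy => by simp [hy], PMF.pure_apply_self, one_mul]

theorem tsum_map_mul (p : PMF Y) (k : Y → X) (f : X → ℝ≥0∞) :
    ∑' x, p.map k x * f x = ∑' y, p y * f (k y) := by
  simp only [PMF.map, tsum_bind_mul, Function.comp_apply, tsum_pure_mul]

theorem sum_toReal_pmf [Fintype X] (p : PMF X) : ∑ x, (p x).toReal = 1 := by
  rw [← ENNReal.toReal_sum fun x _ => p.apply_ne_top x, ← tsum_fintype (L := .unconditional _),
    p.tsum_coe, ENNReal.toReal_one]

end PMF

namespace MDP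

variable {S A : Type*} {M : MDP S A}

theorem le_maxE (W : S → A → ℝ) {s : S} {a : A} (ha : a ∈ M.E s) : W s a ≤ M.maxE W s :=
  Finset.le_sup' (W s) ha

theorem maxE_le {W : S → A → ℝ} {s : S} {r : ℝ} (h : ∀ a ∈ M.E s, W s a ≤ r) : M.maxE W s ≤ r :=
  Finset.sup'_le _ _ h

theorem maxE_mono {W W' : S → A → ℝ} {s : S} (h : ∀ a ∈ M.E s, W s a ≤ W' s a) :
    M.maxE W s ≤ M.maxE W' s :=
  maxE_le fun a ha => (h a ha).trans (le_maxE W' ha)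

theorem exists_maxE_eq (W : S → A → ℝ) (s : S) : ∃ a ∈ M.E s, M.maxE W s = W s a :=
  Finset.exists_mem_eq_sup' _ _

theorem maxE_eq_of_forall_eq {W : S → A → ℝ} {s : S} {r : ℝ} (h : ∀ a ∈ M.E s, W s a = r) :
    M.maxE W s = r := by
  obtain ⟨a, ha, hmax⟩ := exists_maxE_eq (M := M) W s
  rw [hmax, h a ha]

theorem tendsto_maxE {W : ℕ → S → A → ℝ} {w : S → A → ℝ} {s : S}
    (h : ∀ a ∈ M.E s, Tendsto (fun n => W n s a) atTop (𝓝 (w s a))) :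
    Tendsto (fun n => M.maxE (W n) s) atTop (𝓝 (M.maxE w s)) :=
  Tendsto.finset_sup'_nhds_apply (M.E_nonempty s) h

theorem mem_E_of_mem_argmaxE {W : S → A → ℝ} {s : S} {a : A} (h : a ∈ M.argmaxE W s) :
    a ∈ M.E s :=
  Finset.mem_of_mem_filter a h

theorem eq_maxE_of_mem_argmaxE {W : S → A → ℝ} {s : S} {a : A} (h : a ∈ M.argmaxE W s) :
    W s a = M.maxE W s := by
  classical
  obtain ⟨ha, hmax⟩ := Finset.mem_filter.mp h
  exact le_antisymm (le_maxE W ha) (maxE_le hmax)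

theorem eq_of_isTerminal {s s' : S} {a : A} (hs : M.IsTerminal s) (ha : a ∈ M.E s)
    (hs' : s' ∈ (M.Δ s a).support) : s' = s := by
  rwa [(PMF.apply_eq_one_iff _ _).mp (hs a ha)] at hs'

section Expect

variable [Fintype S]

variable (M) in
/-- The expected value of `f` at the successor of `s` under the action `a`. Both `M.value F` and
the right-hand sides of the assignments of BRTDP are of this form. -/
noncomputable def expect (f : S → ℝ) (s : S) (a : A) : ℝ := ∑ s', (M.Δ s a s').toReal * f s'

theorem expect_mono {f g : S → ℝ} (h : ∀ s, f s ≤ g s) (s : S) (a : A) :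
    M.expect f s a ≤ M.expect g s a :=
  Finset.sum_le_sum fun s' _ => mul_le_mul_of_nonneg_left (h s') ENNReal.toReal_nonneg

theorem expect_const (r : ℝ) (s : S) (a : A) : M.expect (fun _ => r) s a = r := by
  rw [expect, ← Finset.sum_mul, sum_toReal_pmf, one_mul]

theorem expect_nonneg {f : S → ℝ} (h : ∀ s, 0 ≤ f s) (s : S) (a : A) : 0 ≤ M.expect f s a :=
  (expect_const 0 s a).symm.trans_le (expect_mono h s a)

theorem expect_le_one {f : S → ℝ} (h : ∀ s, f s ≤ 1) (s : S) (a : A) : M.expect f s a ≤ 1 :=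
  (expect_mono h s a).trans_eq (expect_const 1 s a)

theorem expect_sub (f g : S → ℝ) (s : S) (a : A) :
    M.expect (fun s => f s - g s) s a = M.expect f s a - M.expect g s a := by
  simp only [expect, mul_sub, Finset.sum_sub_distrib]

theorem expect_of_isTerminal {s : S} {a : A} (hs : M.IsTerminal s) (ha : a ∈ M.E s) (f : S → ℝ) :
    M.expect f s a = f s := by
  rw [expect, Finset.sum_eq_single s, hs a ha, ENNReal.toReal_one, one_mul]
  · intro t _ ht
    rw [(PMF.apply_eq_zero_iff _ _).mpr fun h => ht (eq_of_isTerminal hs ha h),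
      ENNReal.toReal_zero, zero_mul]
  · exact fun h => absurd (Finset.mem_univ s) h

theorem tendsto_expect {f : ℕ → S → ℝ} {g : S → ℝ}
    (h : ∀ s, Tendsto (fun n => f n s) atTop (𝓝 (g s))) (s : S) (a : A) :
    Tendsto (fun n => M.expect (f n) s a) atTop (𝓝 (M.expect g s a)) :=
  tendsto_finsetSum _ fun s' _ => (h s').const_mul _

theorem ofReal_expect {f : S → ℝ} (h : ∀ s, 0 ≤ f s) (s : S) (a : A) :
    ENNReal.ofReal (M.expect f s a) = ∑ s', M.Δ s a s' * ENNReal.ofReal (f s') := by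
  rw [expect, ENNReal.ofReal_sum_of_nonneg fun s' _ => mul_nonneg ENNReal.toReal_nonneg (h s')]
  refine Finset.sum_congr rfl fun s' _ => ?_
  rw [ENNReal.ofReal_mul ENNReal.toReal_nonneg, ENNReal.ofReal_toReal (PMF.apply_ne_top _ _)]

theorem eq_of_le_expect {f : S → ℝ} {s s' : S} {a : A} {r : ℝ}
    (hle : ∀ t ∈ (M.Δ s a).support, f t ≤ r) (hr : r ≤ M.expect f s a)
    (hs' : s' ∈ (M.Δ s a).support) : f s' = r := by
  by_contra hne
  refine hr.not_gt ?_
  calc M.expect f s a < M.expect (fun _ => r) s a := by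
        refine Finset.sum_lt_sum (fun t _ => ?_) ⟨s', Finset.mem_univ _, ?_⟩
        · by_cases ht : t ∈ (M.Δ s a).support
          · exact mul_le_mul_of_nonneg_left (hle t ht) ENNReal.toReal_nonneg
          · simp only [(PMF.apply_eq_zero_iff _ _).mpr ht, ENNReal.toReal_zero, zero_mul, le_refl]
        · exact mul_lt_mul_of_pos_left (lt_of_le_of_ne (hle s' hs') hne)
            (ENNReal.toReal_pos hs' (PMF.apply_ne_top _ _))
    _ = r := expect_const r s a

end Expect

theorem exists_isEndComponent_subset [Finite S] {T : Set S} (hT : T.Nonempty)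
    (h : ∀ s ∈ T, ∃ a ∈ M.E s, (M.Δ s a).support ⊆ T) : ∃ T' ⊆ T, ∃ B, M.IsEndComponent T' B := by
  have : Nonempty A := ⟨(M.E_nonempty M.init).choose⟩
  choose! π hE hπ using h
  let IsTrap (T' : Set S) : Prop := T'.Nonempty ∧ ∀ s ∈ T', (M.Δ s (π s)).support ⊆ T'
  obtain ⟨T', hsub, hmin⟩ := exists_minimal_le_of_wellFoundedLT IsTrap T ⟨hT, hπ⟩
  obtain ⟨⟨s₀, hs₀⟩, hclosed⟩ := hmin.prop
  refine ⟨T', hsub, {p | p.1 ∈ T' ∧ p.2 = π p.1}, ⟨(s₀, π s₀), hs₀, rfl⟩, ?_, ?_, ?_⟩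
  · rintro ⟨s, a⟩ ⟨hs, (rfl : a = π s)⟩
    exact ⟨hs, hE s (hsub hs)⟩
  · rintro ⟨s, a⟩ ⟨hs, (rfl : a = π s)⟩ s' hs'
    exact hclosed s hs hs'.ne'
  · intro s hs s' hs'
    refine (hmin.le_of_le (y := {t | t ∈ T' ∧ Relation.ReflTransGen
      (fun x y => ∃ a, (x, a) ∈ {p : S × A | p.1 ∈ T' ∧ p.2 = π p.1} ∧ 0 < M.Δ x a y) s t})
      ⟨⟨s, hs, .refl⟩, ?_⟩ (fun t ht => ht.1) hs').2
    rintro t ⟨ht, hst⟩ t' ht'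
    exact ⟨hclosed t ht ht', hst.tail ⟨π t, ⟨ht, rfl⟩, pos_iff_ne_zero.mpr ht'⟩⟩

namespace OnlyTrivialECs

variable {zero one : S}

theorem zero_mem_or_one_mem_of_closed [Finite S] (hM : M.OnlyTrivialECs zero one) {T : Set S}
    (hT : T.Nonempty) (h : ∀ s ∈ T, ∃ a ∈ M.E s, (M.Δ s a).support ⊆ T) : zero ∈ T ∨ one ∈ T := by
  obtain ⟨T', hsub, B, hB⟩ := exists_isEndComponent_subset hT h
  exact (hM.trivial_of_ec T' B hB).imp (fun h => hsub (h.symm.subset (Set.mem_singleton zero)))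
    fun h => hsub (h.symm.subset (Set.mem_singleton one))

theorem nonpos_of_le_expect [Fintype S] (hM : M.OnlyTrivialECs zero one) {T : Set S} {f : S → ℝ}
    (hzero : f zero ≤ 0) (hone : f one ≤ 0)
    (h : ∀ s ∈ T, s ≠ zero → s ≠ one →
      ∃ a ∈ M.E s, (M.Δ s a).support ⊆ T ∧ f s ≤ M.expect f s a) {s : S} (hs : s ∈ T) :
    f s ≤ 0 := by
  by_contra! hpos
  obtain ⟨s₀, hs₀, hmax⟩ := Set.exists_max_image T f T.toFinite ⟨s, hs⟩
  have hpos₀ : 0 < f s₀ := hpos.trans_le (hmax s hs)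
  let T' : Set S := {t | t ∈ T ∧ f t = f s₀}
  have hT' : T'.Nonempty := ⟨s₀, hs₀, rfl⟩
  have hclosed (t : S) (ht : t ∈ T') : ∃ a ∈ M.E t, (M.Δ t a).support ⊆ T' := by
    obtain ⟨htT, hft⟩ := ht
    obtain ⟨a, ha, hsucc, hle⟩ := h t htT (by rintro rfl; linarith) (by rintro rfl; linarith)
    exact ⟨a, ha, fun t' ht' => ⟨hsucc ht', eq_of_le_expect (fun u hu => hmax u (hsucc hu))
      (hft ▸ hle) ht'⟩⟩
  rcases hM.zero_mem_or_one_mem_of_closed hT' hclosed with ⟨-, hz⟩ | ⟨-, ho⟩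
  · exact (hz ▸ hzero).not_gt hpos₀
  · exact (ho ▸ hone).not_gt hpos₀

end OnlyTrivialECs

end MDP

/-! ## The optimality equation -/

/-- The number of actions in a finite sequence, i.e. of the steps taken so far. -/
def FinPath.length {S A : Type*} : FinPath S A → ℕ
  | start _ => 0
  | snoc ω _ _ => ω.length + 1

/-- The first state of a finite sequence. -/
def FinPath.root {S A : Type*} : FinPath S A → S
  | start s => s
  | snoc ω _ _ => ω.root

/-- The sequence passes through the state-action pair `(s, a)`; these are the pairs that the
update phase has still to process. -/
def FinPath.Uses {S A : Type*} : FinPath S A → S → A → Prop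
  | start _, _, _ => False
  | snoc ω b _, s, a => (ω.last = s ∧ b = a) ∨ ω.Uses s a

namespace MDP

open scoped ENNReal

variable {S A : Type*} {M : MDP S A} {F : Set S}

instance pathMeasure_isProbabilityMeasure (σ : M.Strategy) (s : S) :
    IsProbabilityMeasure (M.pathMeasure σ s) :=
  chainLaw_isProbabilityMeasure _ _

theorem pathMeasure_ae_zero (σ : M.Strategy) (s : S) :
    ∀ᵐ ω ∂(M.pathMeasure σ s), ω 0 = FinPath.start s :=
  chainLaw_ae_zero _ _

theorem pathMeasure_ae_step (σ : M.Strategy) (s : S) : ∀ᵐ ω ∂(M.pathMeasure σ s), ∀ n,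
    ∃ a ∈ M.E (ω n).last, ∃ t ∈ (M.Δ (ω n).last a).support, ω (n + 1) = (ω n).snoc a t := by
  filter_upwards [chainLaw_ae_mem_support (M.strategyStep σ) (.start s)] with ω hω n
  obtain ⟨a, ha, hmap⟩ := (PMF.mem_support_bind_iff _ _ _).mp (hω n)
  obtain ⟨t, ht, heq⟩ := (PMF.mem_support_map_iff _ _ _).mp hmap
  exact ⟨a, σ.enabled _ a ha, t, ht, heq.symm⟩

theorem pathMeasure_ae_length (σ : M.Strategy) (s : S) :
    ∀ᵐ ω ∂(M.pathMeasure σ s), ∀ n, (ω n).length = n := by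
  filter_upwards [pathMeasure_ae_zero σ s, pathMeasure_ae_step σ s] with ω h₀ hstep n
  induction n with
  | zero => rw [h₀, FinPath.length]
  | succ n ih =>
    obtain ⟨a, -, t, -, heq⟩ := hstep n
    rw [heq, FinPath.length, ih]

theorem pathMeasure_ae_stays (hF : ∀ t ∈ F, M.IsTerminal t) (σ : M.Strategy) (s : S) :
    ∀ᵐ ω ∂(M.pathMeasure σ s), ∀ m n, m ≤ n → (ω m).last ∈ F → (ω n).last ∈ F := by
  filter_upwards [pathMeasure_ae_step σ s] with ω hstep m n hmn hm
  induction n, hmn using Nat.le_induction with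
  | base => exact hm
  | succ n _ ih =>
    obtain ⟨a, ha, t, ht, heq⟩ := hstep n
    rw [heq, FinPath.last, eq_of_isTerminal (hF _ ih) ha ht]
    exact ih

theorem lintegral_strategyStep [Fintype S] (σ : M.Strategy) (ω : FinPath S A) {f : S → ℝ}
    (hf : ∀ s, 0 ≤ f s) :
    ∫⁻ y, ENNReal.ofReal (f y.last) ∂(M.strategyStep σ ω).toMeasure =
      ∑' a, σ.act ω a * ENNReal.ofReal (M.expect f ω.last a) := by
  rw [lintegral_pmf_toMeasure, strategyStep, tsum_bind_mul]
  refine tsum_congr fun a => ?_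
  rw [tsum_map_mul, tsum_fintype, ofReal_expect hf]
  rfl

theorem lintegral_pathMeasure_succ [Fintype S] (σ : M.Strategy) (s : S) (n : ℕ) {f : S → ℝ}
    (hf : ∀ s, 0 ≤ f s) :
    ∫⁻ ω, ENNReal.ofReal (f (ω (n + 1)).last) ∂(M.pathMeasure σ s) =
      ∫⁻ ω, ∑' a, σ.act (ω n) a * ENNReal.ofReal (M.expect f (ω n).last a)
        ∂(M.pathMeasure σ s) := by
  simp only [← lintegral_strategyStep σ _ hf]
  exact lintegral_chainLaw_succ (M.strategyStep σ) (.start s) n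
    (f := fun y => ENNReal.ofReal (f y.last))

theorem lintegral_pathMeasure_zero (σ : M.Strategy) (s : S) (f : S → ℝ) :
    ∫⁻ ω, ENNReal.ofReal (f (ω 0).last) ∂(M.pathMeasure σ s) = ENNReal.ofReal (f s) := by
  rw [lintegral_congr_ae (g := fun _ => ENNReal.ofReal (f s)), lintegral_const, measure_univ,
    mul_one]
  filter_upwards [pathMeasure_ae_zero σ s] with ω h₀
  rw [h₀, FinPath.last]

theorem lintegral_indicator_last (σ : M.Strategy) (s : S) (n : ℕ) :
    ∫⁻ ω, ENNReal.ofReal (F.indicator 1 (ω n).last) ∂(M.pathMeasure σ s) =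
      M.pathMeasure σ s {ω | (ω n).last ∈ F} := by
  have hmeas : MeasurableSet {ω : ℕ → FinPath S A | (ω n).last ∈ F} :=
    measurableSet_apply_mem n {y : FinPath S A | y.last ∈ F}
  rw [← lintegral_indicator_one hmeas]
  refine lintegral_congr fun ω => ?_
  by_cases h : (ω n).last ∈ F <;> simp [Set.indicator, h]

theorem reachProb_le_one (F : Set S) (σ : M.Strategy) (s : S) : M.reachProb F σ s ≤ 1 :=
  measureReal_le_one

theorem reachProb_le_stateValue (F : Set S) (σ : M.Strategy) (s : S) :
    M.reachProb F σ s ≤ M.stateValue F s :=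
  le_ciSup (f := (M.reachProb F · s)) ⟨1, Set.forall_mem_range.mpr (reachProb_le_one F · s)⟩ σ

theorem stateValue_nonneg (F : Set S) (s : S) : 0 ≤ M.stateValue F s :=
  Real.iSup_nonneg fun _ => measureReal_nonneg

theorem stateValue_le_one (F : Set S) (s : S) : M.stateValue F s ≤ 1 :=
  Real.iSup_le (reachProb_le_one F · s) zero_le_one

theorem measureReal_last_mem_le_reachProb (σ : M.Strategy) (s : S) (n : ℕ) :
    (M.pathMeasure σ s).real {ω | (ω n).last ∈ F} ≤ M.reachProb F σ s :=
  measureReal_mono fun _ h => ⟨n, h⟩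

theorem ofReal_reachProb_eq_iSup (hF : ∀ t ∈ F, M.IsTerminal t) (σ : M.Strategy) (s : S) :
    ENNReal.ofReal (M.reachProb F σ s) = ⨆ n, M.pathMeasure σ s {ω | (ω n).last ∈ F} := by
  rw [reachProb, ofReal_measureReal, Set.ofPred_exists, measure_iUnion_eq_iSup_accumulate]
  refine iSup_congr fun n => measure_congr ?_
  filter_upwards [pathMeasure_ae_stays hF σ s] with ω hω
  refine propext ⟨fun h => ?_, fun h => Set.mem_accumulate.mpr ⟨n, le_rfl, h⟩⟩
  obtain ⟨m, hmn, hm⟩ := Set.mem_accumulate.mp h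
  exact hω m n hmn hm

section Supersolution

variable [Fintype S]

theorem lintegral_pathMeasure_le_of_supersolution {W : S → ℝ} (hW : ∀ s, 0 ≤ W s)
    (hsuper : ∀ s, ∀ a ∈ M.E s, M.expect W s a ≤ W s) (σ : M.Strategy) (s : S) (n : ℕ) :
    ∫⁻ ω, ENNReal.ofReal (W (ω n).last) ∂(M.pathMeasure σ s) ≤ ENNReal.ofReal (W s) := by
  induction n with
  | zero => rw [lintegral_pathMeasure_zero]
  | succ n ih =>
    rw [lintegral_pathMeasure_succ σ s n hW]
    refine (lintegral_mono fun ω => ?_).trans ih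
    calc ∑' a, σ.act (ω n) a * ENNReal.ofReal (M.expect W (ω n).last a)
        ≤ ∑' a, σ.act (ω n) a * ENNReal.ofReal (W (ω n).last) := by
          refine ENNReal.tsum_le_tsum fun a => ?_
          by_cases ha : a ∈ (σ.act (ω n)).support
          · gcongr
            exact hsuper _ a (σ.enabled _ a ha)
          · simp only [(PMF.apply_eq_zero_iff _ _).mpr ha, zero_mul, le_refl]
      _ = ENNReal.ofReal (W (ω n).last) := by rw [ENNReal.tsum_mul_right, PMF.tsum_coe, one_mul]

theorem stateValue_le_of_supersolution (hF : ∀ t ∈ F, M.IsTerminal t) {W : S → ℝ}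
    (hW : ∀ s, 0 ≤ W s) (hWF : ∀ s ∈ F, 1 ≤ W s)
    (hsuper : ∀ s, ∀ a ∈ M.E s, M.expect W s a ≤ W s) (s : S) : M.stateValue F s ≤ W s := by
  refine Real.iSup_le (fun σ => ?_) (hW s)
  rw [← ENNReal.ofReal_le_ofReal_iff (hW s), ofReal_reachProb_eq_iSup hF]
  refine iSup_le fun n => ?_
  rw [← lintegral_indicator_last]
  refine le_trans (lintegral_mono fun ω => ENNReal.ofReal_le_ofReal ?_)
    (lintegral_pathMeasure_le_of_supersolution hW hsuper σ s n)
  exact Set.indicator_le' (g := W) (fun t ht => hWF t ht) (fun t _ => hW t) (ω n).last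

end Supersolution

section Horizon

variable [Fintype S]

variable (M F) in
/-- The largest probability of being in `F` after `n` steps, given by value iteration. -/
noncomputable def horizonValue : ℕ → S → ℝ
  | 0 => F.indicator 1
  | n + 1 => M.maxE (M.expect (horizonValue n))

variable (M F) in
/-- The strategy which, for `n` steps, takes an action that is optimal for the number of steps
remaining. -/
noncomputable def horizonStrategy (n : ℕ) : M.Strategy where
  act ω := PMF.pure
    (exists_maxE_eq (M := M) (M.expect (M.horizonValue F (n - (ω.length + 1)))) ω.last).choose
  enabled ω a ha := by
    rw [(PMF.mem_support_pure_iff _ _).mp ha]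
    exact (exists_maxE_eq _ _).choose_spec.1

theorem horizonValue_nonneg (n : ℕ) (s : S) : 0 ≤ M.horizonValue F n s := by
  induction n generalizing s with
  | zero => exact Set.indicator_nonneg (fun _ _ => zero_le_one) s
  | succ n ih =>
    obtain ⟨a, -, hmax⟩ := exists_maxE_eq (M := M) (M.expect (M.horizonValue F n)) s
    exact (expect_nonneg ih s a).trans_eq hmax.symm

theorem lintegral_horizonStrategy {n m : ℕ} (hm : m ≤ n) (s : S) :
    ∫⁻ ω, ENNReal.ofReal (M.horizonValue F (n - m) (ω m).last)
        ∂(M.pathMeasure (M.horizonStrategy F n) s) = ENNReal.ofReal (M.horizonValue F n s) := by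
  induction m with
  | zero => exact lintegral_pathMeasure_zero _ s _
  | succ m ih =>
    rw [← ih (by lia), lintegral_pathMeasure_succ _ s m (horizonValue_nonneg _)]
    refine lintegral_congr_ae ?_
    filter_upwards [pathMeasure_ae_length (M.horizonStrategy F n) s] with ω hlength
    have hopt := (exists_maxE_eq (M := M)
      (M.expect (M.horizonValue F (n - ((ω m).length + 1)))) (ω m).last).choose_spec.2
    simp only [horizonStrategy, tsum_pure_mul, hlength m] at hopt ⊢
    rw [← hopt, show n - m = n - (m + 1) + 1 by lia, horizonValue]

theorem horizonValue_le_stateValue (n : ℕ) (s : S) : M.horizonValue F n s ≤ M.stateValue F s := by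
  let σ := M.horizonStrategy F n
  have hreach : ENNReal.ofReal (M.horizonValue F n s) =
      M.pathMeasure σ s {ω | (ω n).last ∈ F} := by
    rw [← lintegral_horizonStrategy le_rfl, Nat.sub_self, horizonValue, lintegral_indicator_last]
  calc M.horizonValue F n s = (M.pathMeasure σ s).real {ω | (ω n).last ∈ F} := by
        rw [measureReal_def, ← hreach, ENNReal.toReal_ofReal (horizonValue_nonneg n s)]
    _ ≤ M.reachProb F σ s := measureReal_last_mem_le_reachProb σ s n
    _ ≤ M.stateValue F s := reachProb_le_stateValue F σ s

theorem horizonValue_le_one (n : ℕ) (s : S) : M.horizonValue F n s ≤ 1 := by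
  induction n generalizing s with
  | zero => exact Set.indicator_le' (fun _ _ => le_rfl) (fun _ _ => zero_le_one) s
  | succ n ih => exact maxE_le fun a _ => expect_le_one ih s a

theorem horizonValue_of_isTerminal {s : S} (hs : M.IsTerminal s) (n : ℕ) :
    M.horizonValue F n s = F.indicator 1 s := by
  induction n with
  | zero => rfl
  | succ n ih => exact maxE_eq_of_forall_eq fun a ha => (expect_of_isTerminal hs ha _).trans ih

theorem monotone_horizonValue (hF : ∀ t ∈ F, M.IsTerminal t) (s : S) :
    Monotone fun n => M.horizonValue F n s := by
  refine monotone_nat_of_le_succ fun n => ?_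
  induction n generalizing s with
  | zero =>
    by_cases hs : s ∈ F
    · exact (horizonValue_of_isTerminal (hF s hs) 1).ge
    · exact (Set.indicator_of_notMem hs 1).trans_le (horizonValue_nonneg 1 s)
  | succ n ih => exact maxE_mono fun a _ => expect_mono ih s a

theorem tendsto_horizonValue (hF : ∀ t ∈ F, M.IsTerminal t) (s : S) :
    Tendsto (fun n => M.horizonValue F n s) atTop (𝓝 (M.stateValue F s)) := by
  let v : S → ℝ := fun s => ⨆ n, M.horizonValue F n s
  have hbdd (s : S) : BddAbove (Set.range fun n => M.horizonValue F n s) :=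
    ⟨1, Set.forall_mem_range.mpr (horizonValue_le_one · s)⟩
  have htendsto (s : S) : Tendsto (fun n => M.horizonValue F n s) atTop (𝓝 (v s)) :=
    tendsto_atTop_ciSup (monotone_horizonValue hF s) (hbdd s)
  have hsuper (s : S) (a : A) (ha : a ∈ M.E s) : M.expect v s a ≤ v s :=
    le_of_tendsto (tendsto_expect htendsto s a) (.of_forall fun n =>
      (le_maxE (M.expect (M.horizonValue F n)) ha).trans (le_ciSup (hbdd s) (n + 1)))
  have hle : M.stateValue F s ≤ v s := by
    refine stateValue_le_of_supersolution hF (fun s => ?_) (fun s hs => ?_) hsuper s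
    · exact (horizonValue_nonneg 0 s).trans (le_ciSup (hbdd s) 0)
    · exact (Set.indicator_of_mem hs 1).ge.trans (le_ciSup (hbdd s) 0)
  rw [hle.antisymm (ciSup_le fun n => horizonValue_le_stateValue n s)]
  exact htendsto s

end Horizon

variable [Fintype S]

theorem stateValue_eq_maxE_value (hF : ∀ t ∈ F, M.IsTerminal t) (s : S) :
    M.stateValue F s = M.maxE (M.value F) s :=
  tendsto_nhds_unique ((tendsto_horizonValue hF s).comp (tendsto_add_atTop_nat 1))
    (tendsto_maxE fun a _ => tendsto_expect (tendsto_horizonValue hF) s a)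

theorem value_of_isTerminal (hF : ∀ t ∈ F, M.IsTerminal t) {s : S} {a : A} (hs : M.IsTerminal s)
    (ha : a ∈ M.E s) : M.value F s a = F.indicator 1 s := by
  refine (expect_of_isTerminal hs ha _).trans (tendsto_nhds_unique (tendsto_horizonValue hF s) ?_)
  simp only [horizonValue_of_isTerminal hs, tendsto_const_nhds]

end MDP

/-! ## Bounds, fairness and convergence of BRTDP -/

namespace BRTDP

open MDP

section Bounds

variable {S A : Type*} {M : MDP S A} {zero one : S} {W : S → A → ℝ}

section Initial

theorem initial_U_zero (a : A) : (initial M zero one).U zero a = 0 :=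
  if_pos rfl

theorem initial_U_of_ne {s : S} (h : s ≠ zero) (a : A) : (initial M zero one).U s a = 1 :=
  if_neg h

theorem initial_L_one (a : A) : (initial M zero one).L one a = 1 :=
  if_pos rfl

theorem initial_L_of_ne {s : S} (h : s ≠ one) (a : A) : (initial M zero one).L s a = 0 :=
  if_neg h

theorem initial_U_le_one (s : S) (a : A) : (initial M zero one).U s a ≤ 1 := by
  by_cases h : s = zero
  · exact h ▸ (initial_U_zero a).trans_le zero_le_one
  · exact (initial_U_of_ne h a).le

theorem initial_L_nonneg (s : S) (a : A) : 0 ≤ (initial M zero one).L s a := by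
  by_cases h : s = one
  · exact h ▸ zero_le_one.trans_eq (initial_L_one a).symm
  · exact (initial_L_of_ne h a).ge

theorem initial_U_le_initial_L {t : S} (ht : t = one ∨ t = zero) (a : A) :
    (initial M zero one).U t a ≤ (initial M zero one).L t a := by
  rcases ht with rfl | rfl
  · exact (initial_U_le_one t a).trans_eq (initial_L_one a).symm
  · exact (initial_U_zero a).trans_le (initial_L_nonneg t a)

end Initial

variable {quit : (S → A → ℝ) → (S → A → ℝ) → Prop}

variable (M quit) in
/-- The invariant of the control flow: paths start in the initial state, every update phase has
something to update, and the algorithm halts only if the stopping condition holds. -/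
structure WellFormed (c : Config S A) : Prop where
  root_eq : c.path.root = M.init
  exists_snoc : c.phase = .update → ∃ ω a s, c.path = .snoc ω a s
  quit_of_halted : c.phase = .halted → quit c.U c.L

theorem wellFormed_initial : WellFormed M quit (initial M zero one) :=
  ⟨rfl, nofun, nofun⟩

variable [Fintype S]

section Backup

theorem backup_self (W : S → A → ℝ) (s : S) (a : A) :
    backup M W s a s a = M.expect (M.maxE W) s a :=
  if_pos ⟨rfl, rfl⟩

theorem backup_of_ne (W : S → A → ℝ) {s t : S} {a b : A} (h : ¬(t = s ∧ b = a)) :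
    backup M W s a t b = W t b :=
  if_neg h

variable (M) in
/-- `W` is a supersolution of the optimality equation, so that no assignment increases it. -/
def IsSupersolution (W : S → A → ℝ) : Prop := ∀ s, ∀ a ∈ M.E s, M.expect (M.maxE W) s a ≤ W s a

variable (M) in
/-- `W` is a subsolution of the optimality equation, so that no assignment decreases it. -/
def IsSubsolution (W : S → A → ℝ) : Prop := ∀ s, ∀ a ∈ M.E s, W s a ≤ M.expect (M.maxE W) s a

theorem IsSupersolution.backup_le (hW : IsSupersolution M W) (s : S) (a : A) {t : S} {b : A}
    (hb : b ∈ M.E t) : backup M W s a t b ≤ W t b := by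
  by_cases h : t = s ∧ b = a
  · obtain ⟨rfl, rfl⟩ := h
    exact (backup_self W t b).trans_le (hW t b hb)
  · exact (backup_of_ne W h).le

theorem IsSubsolution.le_backup (hW : IsSubsolution M W) (s : S) (a : A) {t : S} {b : A}
    (hb : b ∈ M.E t) : W t b ≤ backup M W s a t b := by
  by_cases h : t = s ∧ b = a
  · obtain ⟨rfl, rfl⟩ := h
    exact (hW t b hb).trans_eq (backup_self W t b).symm
  · exact (backup_of_ne W h).ge

theorem IsSupersolution.backup (hW : IsSupersolution M W) (s : S) (a : A) :
    IsSupersolution M (backup M W s a) := by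
  intro t b hb
  have hle : M.expect (M.maxE (BRTDP.backup M W s a)) t b ≤ M.expect (M.maxE W) t b :=
    expect_mono (fun t => maxE_mono fun b hb => hW.backup_le s a hb) t b
  by_cases h : t = s ∧ b = a
  · obtain ⟨rfl, rfl⟩ := h
    exact hle.trans_eq (backup_self W t b).symm
  · exact hle.trans ((hW t b hb).trans_eq (backup_of_ne W h).symm)

theorem IsSubsolution.backup (hW : IsSubsolution M W) (s : S) (a : A) :
    IsSubsolution M (backup M W s a) := by
  intro t b hb
  have hle : M.expect (M.maxE W) t b ≤ M.expect (M.maxE (BRTDP.backup M W s a)) t b :=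
    expect_mono (fun t => maxE_mono fun b hb => hW.le_backup s a hb) t b
  by_cases h : t = s ∧ b = a
  · obtain ⟨rfl, rfl⟩ := h
    exact (backup_self W t b).trans_le hle
  · exact (backup_of_ne W h).trans_le ((hW t b hb).trans hle)

theorem value_le_backup {F : Set S} (hF : ∀ t ∈ F, M.IsTerminal t)
    (hW : ∀ s, ∀ a ∈ M.E s, M.value F s a ≤ W s a) (s : S) (a : A) {t : S} {b : A}
    (hb : b ∈ M.E t) : M.value F t b ≤ backup M W s a t b := by
  by_cases h : t = s ∧ b = a
  · obtain ⟨rfl, rfl⟩ := h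
    rw [backup_self]
    exact expect_mono (fun s => (stateValue_eq_maxE_value hF s).trans_le (maxE_mono (hW s))) t b
  · exact (hW t b hb).trans_eq (backup_of_ne W h).symm

theorem backup_le_value {F : Set S} (hF : ∀ t ∈ F, M.IsTerminal t)
    (hW : ∀ s, ∀ a ∈ M.E s, W s a ≤ M.value F s a) (s : S) (a : A) {t : S} {b : A}
    (hb : b ∈ M.E t) : backup M W s a t b ≤ M.value F t b := by
  by_cases h : t = s ∧ b = a
  · obtain ⟨rfl, rfl⟩ := h
    rw [backup_self]
    exact expect_mono
      (fun s => (maxE_mono (hW s)).trans_eq (stateValue_eq_maxE_value hF s).symm) t b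
  · exact (backup_of_ne W h).trans_le (hW t b hb)

theorem isSupersolution_initial_U (hzero : M.IsTerminal zero) :
    IsSupersolution M (initial M zero one).U := by
  intro s a ha
  by_cases h : s = zero
  · subst h
    rw [expect_of_isTerminal hzero ha, initial_U_zero]
    exact maxE_le fun b _ => (initial_U_zero b).le
  · rw [initial_U_of_ne h]
    exact expect_le_one (fun t => maxE_le fun b _ => initial_U_le_one t b) s a

theorem isSubsolution_initial_L (hone : M.IsTerminal one) :
    IsSubsolution M (initial M zero one).L := by
  intro s a ha
  by_cases h : s = one
  · subst h
    rw [expect_of_isTerminal hone ha, initial_L_one]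
    exact (initial_L_one a).ge.trans (le_maxE _ ha)
  · rw [initial_L_of_ne h]
    refine expect_nonneg (fun t => ?_) s a
    obtain ⟨b, hb⟩ := M.E_nonempty t
    exact (initial_L_nonneg t b).trans (le_maxE _ hb)

theorem value_le_initial_U (hne : zero ≠ one) (hzero : M.IsTerminal zero)
    (hone : M.IsTerminal one) {s : S} {a : A} (ha : a ∈ M.E s) :
    M.value {one} s a ≤ (initial M zero one).U s a := by
  by_cases h : s = zero
  · subst h
    rw [value_of_isTerminal (by simpa using hone) hzero ha, initial_U_zero,
      Set.indicator_of_notMem (by simpa using hne)]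
  · rw [initial_U_of_ne h]
    exact expect_le_one (stateValue_le_one {one}) s a

theorem initial_L_le_value (hone : M.IsTerminal one) {s : S} {a : A} (ha : a ∈ M.E s) :
    (initial M zero one).L s a ≤ M.value {one} s a := by
  by_cases h : s = one
  · subst h
    rw [value_of_isTerminal (by simpa using hone) hone ha, initial_L_one,
      Set.indicator_of_mem (Set.mem_singleton s), Pi.one_apply]
  · rw [initial_L_of_ne h]
    exact expect_nonneg (stateValue_nonneg {one}) s a

end Backup

section Transition

variable (M zero one quit) in
/-- The steps of positive probability, as a relation with one constructor per kind of step, for use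
in case analyses. The kind `stuck` occurs in no computation. -/
inductive Transition : Config S A → Config S A → Prop
  | advance {ω a s U L i} (ha : a ∈ M.argmaxE U ω.last) (hs : s ∈ (M.Δ ω.last a).support)
      (hzero : s ≠ zero) (hone : s ≠ one) :
      Transition ⟨.explore, ω, U, L, i⟩ ⟨.explore, ω.snoc a s, U, L, i⟩
  | arrive {ω a s U L i} (ha : a ∈ M.argmaxE U ω.last) (hs : s ∈ (M.Δ ω.last a).support)
      (hterminal : s = one ∨ s = zero) :
      Transition ⟨.explore, ω, U, L, i⟩ ⟨.update, ω.snoc a s, U, L, i⟩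
  | retreat {ω a s b t U L i} :
      Transition ⟨.update, (FinPath.snoc ω a s).snoc b t, U, L, i⟩
        ⟨.update, ω.snoc a s, backup M U s b, backup M L s b, i⟩
  | restart {s a t U L i} (hquit : ¬quit (backup M U s a) (backup M L s a)) :
      Transition ⟨.update, (FinPath.start s).snoc a t, U, L, i⟩
        ⟨.explore, .start s, backup M U s a, backup M L s a, i + 1⟩
  | halt {s a t U L i} (hquit : quit (backup M U s a) (backup M L s a)) :
      Transition ⟨.update, (FinPath.start s).snoc a t, U, L, i⟩
        ⟨.halted, .start s, backup M U s a, backup M L s a, i + 1⟩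
  | stuck {s U L i} : Transition ⟨.update, .start s, U, L, i⟩ ⟨.update, .start s, U, L, i⟩
  | halted {ω U L i} : Transition ⟨.halted, ω, U, L, i⟩ ⟨.halted, ω, U, L, i⟩

theorem transition_of_mem_support {c c' : Config S A}
    (h : c' ∈ (step M zero one quit c).support) : Transition M zero one quit c c' := by
  obtain ⟨phase, ω, U, L, i⟩ := c
  cases phase with
  | explore =>
    obtain ⟨a, ha, hmap⟩ := (PMF.mem_support_bind_iff _ _ _).mp h
    obtain ⟨s, hs, rfl⟩ := (PMF.mem_support_map_iff _ _ _).mp hmap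
    rw [PMF.mem_support_uniformOfFinset_iff] at ha
    by_cases hterminal : s = one ∨ s = zero
    · rw [if_pos hterminal]
      exact .arrive ha hs hterminal
    · rw [if_neg hterminal]
      obtain ⟨hone, hzero⟩ := not_or.mp hterminal
      exact .advance ha hs hzero hone
  | update =>
    obtain rfl := (PMF.mem_support_pure_iff _ _).mp h
    match ω with
    | .start s => exact .stuck
    | .snoc (.snoc ω a s) b t => exact .retreat
    | .snoc (.start s) a t =>
      classical
      change Transition M zero one quit _ ⟨if quit (backup M U s a) (backup M L s a) then .halted
        else .explore, .start s, backup M U s a, backup M L s a, i + 1⟩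
      split_ifs with hquit
      · exact .halt hquit
      · exact .restart hquit
  | halted =>
    obtain rfl := (PMF.mem_support_pure_iff _ _).mp h
    exact .halted

theorem Transition.bounds_eq_or_backup {c c' : Config S A} (h : Transition M zero one quit c c') :
    (c'.U = c.U ∧ c'.L = c.L) ∨
      ∃ s a, c'.U = backup M c.U s a ∧ c'.L = backup M c.L s a := by
  cases h
  case retreat | restart | halt => exact .inr ⟨_, _, rfl, rfl⟩
  all_goals exact .inl ⟨rfl, rfl⟩

theorem WellFormed.transition {c c' : Config S A} (hc : WellFormed M quit c)
    (h : Transition M zero one quit c c') : WellFormed M quit c' := by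
  cases h with
  | advance | restart => exact ⟨hc.root_eq, nofun, nofun⟩
  | arrive | retreat => exact ⟨hc.root_eq, fun _ => ⟨_, _, _, rfl⟩, nofun⟩
  | halt hquit => exact ⟨hc.root_eq, nofun, fun _ => hquit⟩
  | stuck | halted => exact hc

end Transition

namespace IsComputation

variable {ρ : ℕ → Config S A} (hρ : IsComputation M zero one quit ρ)

include hρ

theorem transition (n : ℕ) : Transition M zero one quit (ρ n) (ρ (n + 1)) :=
  transition_of_mem_support (hρ.2 n)

theorem wellFormed (n : ℕ) : WellFormed M quit (ρ n) := by
  induction n with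
  | zero => exact hρ.1 ▸ wellFormed_initial
  | succ n ih => exact ih.transition (hρ.transition n)

theorem U_induction {P : (S → A → ℝ) → Prop} (hinit : P (initial M zero one).U)
    (hbackup : ∀ W s a, P W → P (backup M W s a)) (n : ℕ) : P (ρ n).U := by
  induction n with
  | zero => exact hρ.1 ▸ hinit
  | succ n ih =>
    rcases (hρ.transition n).bounds_eq_or_backup with ⟨hU, -⟩ | ⟨s, a, hU, -⟩
    · exact hU ▸ ih
    · exact hU ▸ hbackup _ s a ih

theorem L_induction {P : (S → A → ℝ) → Prop} (hinit : P (initial M zero one).L)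
    (hbackup : ∀ W s a, P W → P (backup M W s a)) (n : ℕ) : P (ρ n).L := by
  induction n with
  | zero => exact hρ.1 ▸ hinit
  | succ n ih =>
    rcases (hρ.transition n).bounds_eq_or_backup with ⟨-, hL⟩ | ⟨s, a, -, hL⟩
    · exact hL ▸ ih
    · exact hL ▸ hbackup _ s a ih

theorem antitone_U (hzero : M.IsTerminal zero) {s : S} {a : A} (ha : a ∈ M.E s) :
    Antitone fun n => (ρ n).U s a := by
  refine antitone_nat_of_succ_le fun n => ?_
  have hsuper : IsSupersolution M (ρ n).U :=
    hρ.U_induction (isSupersolution_initial_U hzero) (fun W t b hW => hW.backup t b) n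
  rcases (hρ.transition n).bounds_eq_or_backup with ⟨hU, -⟩ | ⟨t, b, hU, -⟩
  · rw [hU]
  · exact hU ▸ hsuper.backup_le t b ha

theorem monotone_L (hone : M.IsTerminal one) {s : S} {a : A} (ha : a ∈ M.E s) :
    Monotone fun n => (ρ n).L s a := by
  refine monotone_nat_of_le_succ fun n => ?_
  have hsub : IsSubsolution M (ρ n).L :=
    hρ.L_induction (isSubsolution_initial_L hone) (fun W t b hW => hW.backup t b) n
  rcases (hρ.transition n).bounds_eq_or_backup with ⟨-, hL⟩ | ⟨t, b, -, hL⟩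
  · rw [hL]
  · exact hL ▸ hsub.le_backup t b ha

theorem value_le_U (hne : zero ≠ one) (hzero : M.IsTerminal zero) (hone : M.IsTerminal one)
    (n : ℕ) {s : S} {a : A} (ha : a ∈ M.E s) : M.value {one} s a ≤ (ρ n).U s a :=
  hρ.U_induction (P := fun W => ∀ s, ∀ a ∈ M.E s, M.value {one} s a ≤ W s a)
    (fun _ _ ha => value_le_initial_U hne hzero hone ha)
    (fun _ s a hW _ _ hb => value_le_backup (by simpa using hone) hW s a hb) n s a ha

theorem L_le_value (hone : M.IsTerminal one) (n : ℕ) {s : S} {a : A} (ha : a ∈ M.E s) :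
    (ρ n).L s a ≤ M.value {one} s a :=
  hρ.L_induction (P := fun W => ∀ s, ∀ a ∈ M.E s, W s a ≤ M.value {one} s a)
    (fun _ _ ha => initial_L_le_value hone ha)
    (fun _ s a hW _ _ hb => backup_le_value (by simpa using hone) hW s a hb) n s a ha

end IsComputation

end Bounds

section Fairness

variable {S A : Type*} [Fintype S] {M : MDP S A} {zero one : S}
  {quit : (S → A → ℝ) → (S → A → ℝ) → Prop} {ρ : ℕ → Config S A}

/-- At time `n`, the exploration of `ρ` draws the action `a` in the state `s`, and then the
successor `t`. -/
def DrawsTo (ρ : ℕ → Config S A) (s : S) (a : A) (t : S) (n : ℕ) : Prop :=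
  ((ρ n).phase = .explore ∧ (ρ n).path.last = s) ∧ ∃ ω, (ρ (n + 1)).path = .snoc ω a t

/-- At time `n`, the exploration of `ρ` draws the action `a` in the state `s`. -/
def Draws (ρ : ℕ → Config S A) (s : S) (a : A) (n : ℕ) : Prop := ∃ t, DrawsTo ρ s a t n

variable (M) in
/-- Whenever the exploration draws a state-action pair infinitely often, it draws all successors of
that pair infinitely often. -/
def Fair (ρ : ℕ → Config S A) : Prop :=
  ∀ s, ∀ a ∈ M.E s, ∀ t ∈ (M.Δ s a).support,
    (∃ᶠ n in atTop, Draws ρ s a n) → ∃ᶠ n in atTop, DrawsTo ρ s a t n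

theorem step_toMeasure_path_preimage {c : Config S A} (hc : c.phase = .explore)
    (K : Set (FinPath S A)) :
    (step M zero one quit c).toMeasure {c' | c'.path ∈ K} =
      ∑' a, PMF.uniformOfFinset (M.argmaxE c.U c.path.last) (M.argmaxE_nonempty c.U c.path.last) a *
        ∑' s, M.Δ c.path.last a s * K.indicator 1 (c.path.snoc a s) := by
  rw [← lintegral_indicator_one (MeasurableSet.of_discrete), lintegral_pmf_toMeasure]
  simp only [step, hc, exploreStep, tsum_bind_mul, tsum_map_mul]
  rfl

theorem step_toMeasure_draws {c : Config S A} (hc : c.phase = .explore) (a : A) :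
    (step M zero one quit c).toMeasure {c' | ∃ t ω, c'.path = .snoc ω a t} =
      PMF.uniformOfFinset (M.argmaxE c.U c.path.last) (M.argmaxE_nonempty c.U c.path.last) a := by
  refine (step_toMeasure_path_preimage hc {ω | ∃ t ω', ω = .snoc ω' a t}).trans ?_
  rw [tsum_eq_single a fun b hb => by simp [hb]]
  simp [-tsum_fintype, PMF.tsum_coe]

theorem step_toMeasure_drawsTo {c : Config S A} (hc : c.phase = .explore) (a : A) (t : S) :
    (step M zero one quit c).toMeasure {c' | ∃ ω, c'.path = .snoc ω a t} =
      PMF.uniformOfFinset (M.argmaxE c.U c.path.last) (M.argmaxE_nonempty c.U c.path.last) a *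
        M.Δ c.path.last a t := by
  refine (step_toMeasure_path_preimage hc {ω | ∃ ω', ω = .snoc ω' a t}).trans ?_
  rw [tsum_eq_single a fun b hb => by simp [hb], tsum_eq_single t fun s hs => by simp [hs]]
  simp

theorem ae_fair : ∀ᵐ ρ ∂(law M zero one quit), Fair M ρ := by
  refine ae_all_iff.mpr fun s => (ae_ball_iff (M.E s).countable_toSet).mpr fun a _ =>
    ae_all_iff.mpr fun t => ?_
  by_cases ht : t ∈ (M.Δ s a).support
  swap
  · exact ae_of_all _ fun _ h => absurd h ht
  have hpos : 0 < (M.Δ s a t).toReal := ENNReal.toReal_pos ht (PMF.apply_ne_top _ _)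
  have hfair := chainLaw_ae_fair (step M zero one quit) (initial M zero one) hpos
    (G := {c | c.phase = .explore ∧ c.path.last = s})
    (H := {c' | ∃ t ω, c'.path = .snoc ω a t}) (H' := {c' | ∃ ω, c'.path = .snoc ω a t}) <| by
      rintro c ⟨hc, rfl⟩
      rw [measureReal_def, measureReal_def, ← ENNReal.toReal_mul, step_toMeasure_draws hc,
        step_toMeasure_drawsTo hc, mul_comm]
  filter_upwards [hfair] with ρ hρ _ hdraws
  exact hρ (hdraws.mono fun n ⟨t, hG, hH⟩ => ⟨hG, t, hH⟩)

theorem ae_isComputation : ∀ᵐ ρ ∂(law M zero one quit), IsComputation M zero one quit ρ := by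
  filter_upwards [chainLaw_ae_zero (step M zero one quit) (initial M zero one),
    chainLaw_ae_mem_support (step M zero one quit) (initial M zero one)] with ρ h₀ hstep
  exact ⟨h₀, hstep⟩

end Fairness

section Phases

variable {S A : Type*} {M : MDP S A} {zero one : S}
  {quit : (S → A → ℝ) → (S → A → ℝ) → Prop} {ρ : ℕ → Config S A}

/-- `ρ` explores the state `s` infinitely often. -/
def Recurrent (ρ : ℕ → Config S A) (s : S) : Prop :=
  ∃ᶠ n in atTop, (ρ n).phase = .explore ∧ (ρ n).path.last = s

theorem DrawsTo.last_eq {s t : S} {a : A} {n : ℕ} (h : DrawsTo ρ s a t n) :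
    (ρ (n + 1)).path.last = t := by
  obtain ⟨-, ω, hpath⟩ := h
  rw [hpath, FinPath.last]

theorem exists_recurrent [Finite S] (h : ∃ᶠ n in atTop, (ρ n).phase = .explore) :
    ∃ s, Recurrent ρ s :=
  frequently_exists.mp (h.mono fun n hn => ⟨(ρ n).path.last, hn, rfl⟩)

variable [Fintype S]

theorem Transition.exists_snoc_of_explore {c c' : Config S A}
    (h : Transition M zero one quit c c') (hc : c.phase = .explore) :
    ∃ a ∈ M.argmaxE c.U c.path.last, ∃ t, c'.path = c.path.snoc a t := by
  cases h with
  | advance ha | arrive ha => exact ⟨_, ha, _, rfl⟩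
  | _ => cases hc

theorem Transition.last_ne_of_explore {c c' : Config S A}
    (h : Transition M zero one quit c c') (hc : c.phase = .explore) (hc' : c'.phase = .explore) :
    c'.path.last ≠ zero ∧ c'.path.last ≠ one := by
  cases h with
  | advance _ _ hzero hone => exact ⟨hzero, hone⟩
  | arrive => cases hc'
  | _ => cases hc

theorem Transition.explore_or_last_eq {c c' : Config S A}
    (h : Transition M zero one quit c c') (hc : c.phase = .explore) :
    c'.phase = .explore ∨ c'.path.last = one ∨ c'.path.last = zero := by
  cases h with
  | advance => exact .inl rfl
  | arrive _ _ hterminal => exact .inr hterminal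
  | _ => cases hc

theorem Recurrent.exists_draws (hρ : IsComputation M zero one quit ρ) {s : S}
    (hs : Recurrent ρ s) :
    ∃ a ∈ M.E s, ∃ᶠ n in atTop, Draws ρ s a n ∧ (ρ n).U s a = M.maxE (ρ n).U s := by
  refine (frequently_exists_finset _).mp (hs.mono ?_)
  rintro n ⟨hphase, rfl⟩
  obtain ⟨a, ha, t, hpath⟩ := (hρ.transition n).exists_snoc_of_explore hphase
  exact ⟨a, mem_E_of_mem_argmaxE ha, ⟨t, ⟨hphase, rfl⟩, _, hpath⟩, eq_maxE_of_mem_argmaxE ha⟩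

theorem Fair.recurrent_or_eq (hρ : IsComputation M zero one quit ρ) (hfair : Fair M ρ) {s t : S}
    {a : A} (ha : a ∈ M.E s) (hdraws : ∃ᶠ n in atTop, Draws ρ s a n)
    (ht : t ∈ (M.Δ s a).support) : Recurrent ρ t ∨ t = one ∨ t = zero := by
  have hdraws' : ∃ᶠ n in atTop, ((ρ (n + 1)).phase = .explore ∧ (ρ (n + 1)).path.last = t) ∨
      t = one ∨ t = zero := (hfair s a ha t ht hdraws).mono fun n hn =>
    ((hρ.transition n).explore_or_last_eq hn.1.1).imp (⟨·, hn.last_eq⟩)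
      (by rw [hn.last_eq]; exact id)
  exact (frequently_or_distrib_right.mp hdraws').imp (tendsto_add_atTop_nat 1).frequently id

theorem Fair.frequently_ne_explore (hρ : IsComputation M zero one quit ρ) (hfair : Fair M ρ)
    (hM : M.OnlyTrivialECs zero one) : ∃ᶠ n in atTop, (ρ n).phase ≠ .explore := by
  intro hexplore
  obtain ⟨N, hN⟩ := eventually_atTop.mp hexplore
  have hphase : ∀ n ≥ N, (ρ n).phase = .explore := fun n hn => not_not.mp (hN n hn)
  have hlast (n : ℕ) (hn : N ≤ n) :
      (ρ (n + 1)).path.last ≠ zero ∧ (ρ (n + 1)).path.last ≠ one :=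
    (hρ.transition n).last_ne_of_explore (hphase n hn) (hphase (n + 1) (hn.trans n.le_succ))
  have hrecurrent (t : S) (ht : Recurrent ρ t) : t ≠ zero ∧ t ≠ one := by
    obtain ⟨n, hn, -, rfl⟩ := frequently_atTop.mp ht (N + 1)
    obtain ⟨k, rfl⟩ := Nat.exists_eq_add_of_le' (N.succ_pos.trans_le hn)
    exact hlast k (Nat.le_of_succ_le_succ hn)
  have hclosed (s : S) (hs : Recurrent ρ s) :
      ∃ a ∈ M.E s, (M.Δ s a).support ⊆ {t | Recurrent ρ t} := by
    obtain ⟨a, ha, hdraws⟩ := hs.exists_draws hρ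
    replace hdraws := hdraws.mono fun n hn => hn.1
    refine ⟨a, ha, fun t ht => (hfair.recurrent_or_eq hρ ha hdraws ht).resolve_right ?_⟩
    obtain ⟨n, hn, hdraw⟩ := frequently_atTop.mp (hfair s a ha t ht hdraws) N
    exact not_or.mpr (hdraw.last_eq ▸ (hlast n hn).symm)
  have hsome : ∃ s, Recurrent ρ s := exists_recurrent (eventually_atTop.mpr ⟨N, hphase⟩).frequently
  rcases hM.zero_mem_or_one_mem_of_closed hsome hclosed with h | h
  · exact (hrecurrent zero h).1 rfl
  · exact (hrecurrent one h).2 rfl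

theorem Transition.path_eq_of_update {c c' : Config S A} (h : Transition M zero one quit c c')
    (hc : c.phase = .update) {ω : FinPath S A} {a : A} {t : S} (hpath : c.path = ω.snoc a t) :
    c'.path = ω := by
  cases h <;> cases hc <;> cases hpath <;> rfl

theorem IsComputation.exists_update_end (hρ : IsComputation M zero one quit ρ) {n : ℕ}
    (hn : (ρ n).phase = .update) :
    ∃ m ≥ n, (ρ m).phase = .update ∧ (ρ (m + 1)).phase ≠ .update := by
  induction hpath : (ρ n).path generalizing n with
  | start s =>
    obtain ⟨ω, a, t, hsnoc⟩ := (hρ.wellFormed n).exists_snoc hn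
    exact nomatch hpath.symm.trans hsnoc
  | snoc ω a t ih =>
    by_cases hsucc : (ρ (n + 1)).phase = .update
    · obtain ⟨m, hm, hend⟩ := ih hsucc ((hρ.transition n).path_eq_of_update hn hpath)
      exact ⟨m, n.le_succ.trans hm, hend⟩
    · exact ⟨n, le_rfl, hn, hsucc⟩

/-- At time `n`, `ρ` completes an iteration of the outer loop and begins the next one. -/
def Restarts (ρ : ℕ → Config S A) (n : ℕ) : Prop :=
  (ρ n).phase = .update ∧ (ρ (n + 1)).phase = .explore

theorem Transition.restart_spec {c c' : Config S A} (h : Transition M zero one quit c c')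
    (hc : c.phase = .update) (hc' : c'.phase = .explore) :
    (∃ s, c'.path = .start s) ∧ ¬quit c'.U c'.L ∧ c'.iter = c.iter + 1 := by
  cases h with
  | restart hquit => exact ⟨⟨_, rfl⟩, hquit, rfl⟩
  | advance | arrive | halted => cases hc
  | _ => cases hc'

namespace Restarts

variable (hρ : IsComputation M zero one quit ρ) {n : ℕ} (h : Restarts ρ n)

include hρ h

theorem path_eq : (ρ (n + 1)).path = .start M.init := by
  obtain ⟨s, hs⟩ := ((hρ.transition n).restart_spec h.1 h.2).1
  rw [hs, ← (hρ.wellFormed (n + 1)).root_eq, hs, FinPath.root]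

theorem not_quit : ¬quit (ρ (n + 1)).U (ρ (n + 1)).L :=
  ((hρ.transition n).restart_spec h.1 h.2).2.1

theorem iter_eq : (ρ (n + 1)).iter = (ρ n).iter + 1 :=
  ((hρ.transition n).restart_spec h.1 h.2).2.2

end Restarts

theorem Fair.exists_halted_or_frequently_restarts (hρ : IsComputation M zero one quit ρ)
    (hfair : Fair M ρ) (hM : M.OnlyTrivialECs zero one) :
    (∃ n, (ρ n).phase = .halted) ∨ ∃ᶠ n in atTop, Restarts ρ n := by
  refine or_iff_not_imp_left.mpr fun hhalt => frequently_atTop.mpr fun N => ?_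
  have hphase (n : ℕ) : (ρ n).phase ≠ .halted := fun h => hhalt ⟨n, h⟩
  obtain ⟨n, hn, hexplore⟩ := frequently_atTop.mp (hfair.frequently_ne_explore hρ hM) N
  have hupdate : (ρ n).phase = .update := by cases h : (ρ n).phase <;> simp_all
  obtain ⟨m, hm, hend, hsucc⟩ := hρ.exists_update_end hupdate
  refine ⟨m, hn.trans hm, hend, ?_⟩
  cases h : (ρ (m + 1)).phase <;> simp_all

end Phases

section Convergence

variable {S A : Type*} [Fintype S] {M : MDP S A} {zero one : S}
  {quit : (S → A → ℝ) → (S → A → ℝ) → Prop} {ρ : ℕ → Config S A}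

/-- The step from `c` to `c'` assigns new values to `U(s, a)` and `L(s, a)`. -/
def BacksUp (M : MDP S A) (c c' : Config S A) (s : S) (a : A) : Prop :=
  c'.U = backup M c.U s a ∧ c'.L = backup M c.L s a

theorem Transition.uses_or_backsUp {c c' : Config S A} (h : Transition M zero one quit c c')
    {s : S} {a : A} (huses : c.path.Uses s a) : c'.path.Uses s a ∨ BacksUp M c c' s a := by
  cases h with
  | advance | arrive => exact .inl (.inr huses)
  | retreat | restart | halt =>
    rcases huses with ⟨rfl, rfl⟩ | huses
    · exact .inr ⟨rfl, rfl⟩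
    · exact .inl huses
  | stuck | halted => exact .inl huses

theorem DrawsTo.uses (hρ : IsComputation M zero one quit ρ) {s t : S} {a : A} {n : ℕ}
    (h : DrawsTo ρ s a t n) : (ρ (n + 1)).path.Uses s a := by
  obtain ⟨⟨hphase, hlast⟩, ω, hω⟩ := h
  obtain ⟨b, -, u, hpath⟩ := (hρ.transition n).exists_snoc_of_explore hphase
  cases hω.symm.trans hpath
  exact hpath ▸ .inl ⟨hlast, rfl⟩

theorem frequently_backsUp (hρ : IsComputation M zero one quit ρ)
    (hrestarts : ∃ᶠ n in atTop, Restarts ρ n) {s : S} {a : A}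
    (hdraws : ∃ᶠ n in atTop, Draws ρ s a n) :
    ∃ᶠ n in atTop, BacksUp M (ρ n) (ρ (n + 1)) s a := by
  refine frequently_atTop.mpr fun N => ?_
  by_contra! hnot
  obtain ⟨n, hn, t, hdraw⟩ := frequently_atTop.mp hdraws N
  have huses : ∀ m ≥ n + 1, (ρ m).path.Uses s a := fun m hm => by
    induction m, hm using Nat.le_induction with
    | base => exact hdraw.uses hρ
    | succ m hm ih =>
      exact ((hρ.transition m).uses_or_backsUp ih).resolve_right
        (hnot m (hn.trans (n.le_succ.trans hm)))
  obtain ⟨m, hm, hrestart⟩ := frequently_atTop.mp hrestarts n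
  have hstart := huses (m + 1) (Nat.succ_le_succ hm)
  rw [hrestart.path_eq hρ] at hstart
  exact hstart

theorem IsComputation.exists_tendsto_U (hρ : IsComputation M zero one quit ρ) (hne : zero ≠ one)
    (hzero : M.IsTerminal zero) (hone : M.IsTerminal one) :
    ∃ u : S → A → ℝ, ∀ s, ∀ a ∈ M.E s, Tendsto (fun n => (ρ n).U s a) atTop (𝓝 (u s a)) :=
  ⟨fun s a => ⨅ n, (ρ n).U s a, fun s a ha => tendsto_atTop_ciInf (hρ.antitone_U hzero ha)
    ⟨M.value {one} s a, Set.forall_mem_range.mpr fun n => hρ.value_le_U hne hzero hone n ha⟩⟩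

theorem IsComputation.exists_tendsto_L (hρ : IsComputation M zero one quit ρ)
    (hone : M.IsTerminal one) :
    ∃ l : S → A → ℝ, ∀ s, ∀ a ∈ M.E s, Tendsto (fun n => (ρ n).L s a) atTop (𝓝 (l s a)) :=
  ⟨fun s a => ⨆ n, (ρ n).L s a, fun s a ha => tendsto_atTop_ciSup (hρ.monotone_L hone ha)
    ⟨M.value {one} s a, Set.forall_mem_range.mpr fun n => hρ.L_le_value hone n ha⟩⟩

theorem eq_expect_of_frequently_backup {W : ℕ → S → A → ℝ} {w : S → A → ℝ}
    (hW : ∀ s, ∀ a ∈ M.E s, Tendsto (fun n => W n s a) atTop (𝓝 (w s a))) {s : S} {a : A}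
    (ha : a ∈ M.E s) (h : ∃ᶠ n in atTop, W (n + 1) = backup M (W n) s a) :
    w s a = M.expect (M.maxE w) s a :=
  tendsto_nhds_unique_of_frequently_eq ((tendsto_add_atTop_iff_nat 1).mpr (hW s a ha))
    (tendsto_expect (fun s => tendsto_maxE (hW s)) s a)
    (h.mono fun n hn => by rw [hn, backup_self])

variable {u l : S → A → ℝ}

theorem Recurrent.exists_gap_le_expect (hρ : IsComputation M zero one quit ρ)
    (hU : ∀ s, ∀ a ∈ M.E s, Tendsto (fun n => (ρ n).U s a) atTop (𝓝 (u s a)))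
    (hL : ∀ s, ∀ a ∈ M.E s, Tendsto (fun n => (ρ n).L s a) atTop (𝓝 (l s a)))
    (hrestarts : ∃ᶠ n in atTop, Restarts ρ n) {s : S} (hs : Recurrent ρ s) :
    ∃ a ∈ M.E s, (∃ᶠ n in atTop, Draws ρ s a n) ∧
      M.maxE u s - M.maxE l s ≤ M.expect (fun t => M.maxE u t - M.maxE l t) s a := by
  obtain ⟨a, ha, hdraws⟩ := hs.exists_draws hρ
  have hmax : u s a = M.maxE u s := tendsto_nhds_unique_of_frequently_eq (hU s a ha)
    (tendsto_maxE (hU s)) (hdraws.mono fun n hn => hn.2)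
  replace hdraws := hdraws.mono fun n hn => hn.1
  have hbackup := frequently_backsUp hρ hrestarts hdraws
  have hu := eq_expect_of_frequently_backup hU ha (hbackup.mono fun n hn => hn.1)
  have hl := eq_expect_of_frequently_backup hL ha (hbackup.mono fun n hn => hn.2)
  refine ⟨a, ha, hdraws, ?_⟩
  calc M.maxE u s - M.maxE l s ≤ u s a - l s a := by
        rw [hmax]
        exact sub_le_sub_left (le_maxE l ha) _
    _ = M.expect (fun t => M.maxE u t - M.maxE l t) s a := by rw [hu, hl, expect_sub]

theorem IsComputation.limit_gap_nonpos (hρ : IsComputation M zero one quit ρ)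
    (hzero : M.IsTerminal zero) (hone : M.IsTerminal one)
    (hU : ∀ s, ∀ a ∈ M.E s, Tendsto (fun n => (ρ n).U s a) atTop (𝓝 (u s a)))
    (hL : ∀ s, ∀ a ∈ M.E s, Tendsto (fun n => (ρ n).L s a) atTop (𝓝 (l s a))) {t : S}
    (ht : t = one ∨ t = zero) : M.maxE u t - M.maxE l t ≤ 0 := by
  refine sub_nonpos.mpr (maxE_mono fun a ha => ?_)
  calc u t a ≤ (ρ 0).U t a := (hρ.antitone_U hzero ha).le_of_tendsto (hU t a ha) 0
    _ ≤ (ρ 0).L t a := hρ.1 ▸ initial_U_le_initial_L ht a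
    _ ≤ l t a := (hρ.monotone_L hone ha).ge_of_tendsto (hL t a ha) 0

theorem Fair.tendsto_gap (hρ : IsComputation M zero one quit ρ) (hfair : Fair M ρ)
    (hM : M.OnlyTrivialECs zero one) (hrestarts : ∃ᶠ n in atTop, Restarts ρ n) {s : S}
    (hs : Recurrent ρ s) :
    Tendsto (fun n => M.maxE (ρ n).U s - M.maxE (ρ n).L s) atTop (𝓝 0) := by
  obtain ⟨u, hU⟩ := hρ.exists_tendsto_U hM.ne hM.terminal_zero hM.terminal_one
  obtain ⟨l, hL⟩ := hρ.exists_tendsto_L hM.terminal_one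
  have hgap := (tendsto_maxE (hU s)).sub (tendsto_maxE (hL s))
  have hterminal {t : S} (ht : t = one ∨ t = zero) : M.maxE u t - M.maxE l t ≤ 0 :=
    hρ.limit_gap_nonpos hM.terminal_zero hM.terminal_one hU hL ht
  have hle : M.maxE u s - M.maxE l s ≤ 0 := by
    refine hM.nonpos_of_le_expect (T := {t | Recurrent ρ t ∨ t = one ∨ t = zero})
      (f := fun t => M.maxE u t - M.maxE l t) (hterminal (.inr rfl)) (hterminal (.inl rfl))
      (fun t ht hne₀ hne₁ => ?_) (.inl hs)
    obtain ⟨a, ha, hdraws, hle⟩ :=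
      (ht.resolve_right (not_or.mpr ⟨hne₁, hne₀⟩)).exists_gap_le_expect hρ hU hL hrestarts
    exact ⟨a, ha, fun t' => hfair.recurrent_or_eq hρ ha hdraws, hle⟩
  have hge : 0 ≤ M.maxE u s - M.maxE l s := ge_of_tendsto' hgap fun n =>
    sub_nonneg.mpr (maxE_mono fun a ha => (hρ.L_le_value hM.terminal_one n ha).trans
      (hρ.value_le_U hM.ne hM.terminal_zero hM.terminal_one n ha))
  rwa [le_antisymm hle hge] at hgap

theorem recurrent_init (hρ : IsComputation M zero one quit ρ)
    (hrestarts : ∃ᶠ n in atTop, Restarts ρ n) : Recurrent ρ M.init :=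
  (tendsto_add_atTop_nat 1).frequently
    (hrestarts.mono fun n hn => ⟨hn.2, by rw [hn.path_eq hρ, FinPath.last]⟩)

end Convergence

section Termination

variable {S A : Type*} [Fintype S] {M : MDP S A} {zero one : S}
  {quit : (S → A → ℝ) → (S → A → ℝ) → Prop} {ρ : ℕ → Config S A}

theorem Fair.exists_halted {ε : ℝ} (hρ : IsComputation M zero one (precise M ε) ρ)
    (hfair : Fair M ρ) (hM : M.OnlyTrivialECs zero one) (hε : 0 < ε) :
    ∃ n, (ρ n).phase = .halted := by
  refine (hfair.exists_halted_or_frequently_restarts hρ hM).resolve_right fun hrestarts => ?_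
  have hgap := hfair.tendsto_gap hρ hM hrestarts (recurrent_init hρ hrestarts)
  have hprecise : ∀ᶠ n in atTop, precise M ε (ρ n).U (ρ n).L := hgap.eventually_lt_const hε
  obtain ⟨n, hrestart, hn⟩ :=
    (hrestarts.and_eventually ((tendsto_add_atTop_nat 1).eventually hprecise)).exists
  exact hrestart.not_quit hρ hn

theorem Transition.iter_eq_or_eq_succ {c c' : Config S A} (h : Transition M zero one quit c c') :
    c'.iter = c.iter ∨ c'.iter = c.iter + 1 := by
  cases h with
  | restart | halt => exact .inr rfl
  | _ => exact .inl rfl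

theorem monotone_iter (hρ : IsComputation M zero one quit ρ) : Monotone fun n => (ρ n).iter :=
  monotone_nat_of_le_succ fun n => by
    rcases (hρ.transition n).iter_eq_or_eq_succ with h | h <;> lia

theorem exists_iter_eq_of_le (hρ : IsComputation M zero one quit ρ) {i n : ℕ}
    (hi : i ≤ (ρ n).iter) : ∃ m, (ρ m).iter = i := by
  induction n with
  | zero =>
    rw [hρ.1] at hi
    exact ⟨0, by rw [hρ.1, Nat.le_zero.mp hi, initial]⟩
  | succ n ih =>
    by_cases hn : i ≤ (ρ n).iter
    · exact ih hn
    · exact ⟨n + 1, by rcases (hρ.transition n).iter_eq_or_eq_succ with h | h <;> lia⟩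

theorem exists_iter_eq (hρ : IsComputation M zero one quit ρ)
    (hrestarts : ∃ᶠ n in atTop, Restarts ρ n) (i : ℕ) : ∃ n, (ρ n).iter = i := by
  suffices h : ∃ n, i ≤ (ρ n).iter from h.elim fun n hn => exists_iter_eq_of_le hρ hn
  induction i with
  | zero => exact ⟨0, Nat.zero_le _⟩
  | succ i ih =>
    obtain ⟨n, hn⟩ := ih
    obtain ⟨m, hm, hrestart⟩ := frequently_atTop.mp hrestarts n
    refine ⟨m + 1, ?_⟩
    rw [hrestart.iter_eq hρ]
    exact Nat.succ_le_succ (hn.trans (monotone_iter hρ hm))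

/-- The time at which the `i`-th iteration of the outer loop is completed, so that
`afterIter ρ i = ρ (completionTime ρ i)`. -/
noncomputable def completionTime (ρ : ℕ → Config S A) (i : ℕ) : ℕ := sInf {n | (ρ n).iter = i}

theorem strictMono_completionTime (hρ : IsComputation M zero one quit ρ)
    (hiter : ∀ i, ∃ n, (ρ n).iter = i) : StrictMono (completionTime ρ) := by
  intro i j hij
  have hcompletion (i : ℕ) : (ρ (completionTime ρ i)).iter = i := Nat.sInf_mem (hiter i)
  refine (monotone_iter hρ).reflect_lt ?_
  rwa [hcompletion, hcompletion]

theorem ae_exists_halted (hM : M.OnlyTrivialECs zero one) {ε : ℝ} (hε : 0 < ε) :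
    ∀ᵐ ρ ∂(law M zero one (precise M ε)), ∃ n, (ρ n).phase = .halted ∧
      precise M ε (ρ n).U (ρ n).L := by
  filter_upwards [ae_isComputation, ae_fair] with ρ hρ hfair
  obtain ⟨n, hn⟩ := hfair.exists_halted hρ hM hε
  exact ⟨n, hn, (hρ.wellFormed n).quit_of_halted hn⟩

theorem ae_never_frequently_restarts (hM : M.OnlyTrivialECs zero one) :
    ∀ᵐ ρ ∂(law M zero one never), ∃ᶠ n in atTop, Restarts ρ n := by
  filter_upwards [ae_isComputation, ae_fair] with ρ hρ hfair
  exact (hfair.exists_halted_or_frequently_restarts hρ hM).resolve_left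
    fun ⟨n, hn⟩ => (hρ.wellFormed n).quit_of_halted hn

end Termination

end BRTDP

theorem mainTheorem3_general {S A : Type*} [Fintype S] (M : MDP S A) (zero one : S)
    (hne : zero ≠ one) (hzero : M.IsTerminal zero) (hone : M.IsTerminal one) :
    (M.OnlyTrivialECs zero one → ∀ ε : ℝ, 0 < ε →
      ∀ᵐ ρ ∂(BRTDP.law M zero one (BRTDP.precise M ε)), ∃ n, (ρ n).phase = BRTDP.Phase.halted ∧
        M.maxE (ρ n).U M.init - M.maxE (ρ n).L M.init < ε ∧
        ∀ a ∈ M.E M.init, (ρ n).L M.init a ≤ M.value {one} M.init a ∧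
          M.value {one} M.init a ≤ (ρ n).U M.init a) ∧
    (∀ quit ρ, BRTDP.IsComputation M zero one quit ρ → ∀ s, ∀ a ∈ M.E s,
      (∀ m n, m ≤ n → (ρ n).U s a ≤ (ρ m).U s a ∧ (ρ m).L s a ≤ (ρ n).L s a) ∧
      ∀ n, (ρ n).L s a ≤ M.value {one} s a ∧ M.value {one} s a ≤ (ρ n).U s a) ∧
    (M.OnlyTrivialECs zero one → ∀ᵐ ρ ∂(BRTDP.law M zero one BRTDP.never),
      (∀ i, ∃ n, (ρ n).iter = i) ∧
      (∀ i j, i ≤ j → ∀ s, ∀ a ∈ M.E s,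
        (BRTDP.afterIter ρ j).U s a ≤ (BRTDP.afterIter ρ i).U s a ∧
        M.value {one} s a ≤ (BRTDP.afterIter ρ j).U s a ∧
        (BRTDP.afterIter ρ j).L s a ≤ M.value {one} s a ∧
        (BRTDP.afterIter ρ i).L s a ≤ (BRTDP.afterIter ρ j).L s a) ∧
      Tendsto (fun i => M.maxE (BRTDP.afterIter ρ i).U M.init -
        M.maxE (BRTDP.afterIter ρ i).L M.init) atTop (𝓝 0)) := by
  refine ⟨fun hM ε hε => ?_, fun quit ρ hρ s a ha => ⟨fun m n hmn =>
    ⟨hρ.antitone_U hzero ha hmn, hρ.monotone_L hone ha hmn⟩,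
    fun n => ⟨hρ.L_le_value hone n ha, hρ.value_le_U hne hzero hone n ha⟩⟩, fun hM => ?_⟩
  · filter_upwards [BRTDP.ae_isComputation, BRTDP.ae_exists_halted hM hε]
      with ρ hρ ⟨n, hhalted, hprecise⟩
    exact ⟨n, hhalted, hprecise, fun a ha =>
      ⟨hρ.L_le_value hone n ha, hρ.value_le_U hne hzero hone n ha⟩⟩
  · filter_upwards [BRTDP.ae_isComputation, BRTDP.ae_fair, BRTDP.ae_never_frequently_restarts hM]
      with ρ hρ hfair hrestarts
    have hiter := BRTDP.exists_iter_eq hρ hrestarts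
    have hmono := BRTDP.strictMono_completionTime hρ hiter
    refine ⟨hiter, fun i j hij s a ha => ⟨hρ.antitone_U hzero ha (hmono.monotone hij),
      hρ.value_le_U hne hzero hone _ ha, hρ.L_le_value hone _ ha,
      hρ.monotone_L hone ha (hmono.monotone hij)⟩, ?_⟩
    exact (hfair.tendsto_gap hρ hM hrestarts (BRTDP.recurrent_init hρ hrestarts)).comp
      hmono.tendsto_atTop

theorem mainTheorem3 {S A : Type*} [Fintype S] [Finite A] (M : MDP S A) (zero one : S)
    (hM : M.OnlyTrivialECs zero one) :
    -- for every precision, the algorithm almost surely terminates, with correct bounds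
    (∀ ε : ℝ, 0 < ε → ∀ᵐ ρ ∂(BRTDP.law M zero one (BRTDP.precise M ε)),
      ∃ n, (ρ n).phase = BRTDP.Phase.halted ∧
        M.maxE (ρ n).U M.init - M.maxE (ρ n).L M.init < ε ∧
        ∀ a ∈ M.E M.init, (ρ n).L M.init a ≤ M.value {one} M.init a ∧
          M.value {one} M.init a ≤ (ρ n).U M.init a) ∧
    -- in every computation, at every time, the bounds are monotone and correct
    (∀ quit ρ, BRTDP.IsComputation M zero one quit ρ → ∀ s, ∀ a ∈ M.E s,
      (∀ m n, m ≤ n → (ρ n).U s a ≤ (ρ m).U s a ∧ (ρ m).L s a ≤ (ρ n).L s a) ∧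
      ∀ n, (ρ n).L s a ≤ M.value {one} s a ∧ M.value {one} s a ≤ (ρ n).U s a) ∧
    -- if the outer loop is never left, then almost surely all iterations are completed, the bounds
    -- after the iterations are monotone and correct, and their gap at the initial state tends to 0
    (∀ᵐ ρ ∂(BRTDP.law M zero one BRTDP.never),
      (∀ i, ∃ n, (ρ n).iter = i) ∧
      (∀ i j, i ≤ j → ∀ s, ∀ a ∈ M.E s,
        (BRTDP.afterIter ρ j).U s a ≤ (BRTDP.afterIter ρ i).U s a ∧
        M.value {one} s a ≤ (BRTDP.afterIter ρ j).U s a ∧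
        (BRTDP.afterIter ρ j).L s a ≤ M.value {one} s a ∧
        (BRTDP.afterIter ρ i).L s a ≤ (BRTDP.afterIter ρ j).L s a) ∧
      Tendsto (fun i => M.maxE (BRTDP.afterIter ρ i).U M.init -
        M.maxE (BRTDP.afterIter ρ i).L M.init) atTop (𝓝 0)) := by
  obtain ⟨hterminates, hbounds, hconverges⟩ :=
    mainTheorem3_general M zero one hM.ne hM.terminal_zero hM.terminal_one
  exact ⟨hterminates hM, hbounds, hconverges hM⟩
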